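/- Let $p>1$ and $g(r)=r|r|^{p-1}$ for $r\in\mathbb R$, and let $C_D([0,1])=\{v\in C([0,1];\mathbb R): v(0)=v(1)=0\}$ be endowed with the supremum norm. For $u\in C_D([0,1])$ let $U^u$ be the unique maximal solution of $$ \begin{cases} \partial_t U=\partial^2_{xx}U+g(U), & t>0,\ 0<x<1,\\ U(t,0)=U(t,1)=0, & t>0,\\ U(0,x)=u(x), & 0\le x\le 1, \end{cases} $$ where a solution on a time interval $[0,T)$ is a continuous function $U$ on $[0,T)\times[0,1]$ which has the derivatives $\partial_tU$, $\partial_xU$, $\partial^2_{xx}U$ on $(0,T)\times(0,1)$ and satisfies the equation there, together with the boundary and initial conditions. Let $[0,\tau^u)$, $0<\tau^u\le+\infty$, be its maximal interval of existence, so that $\tau^u$ is the supremum of all $T>0$ for which a solution on $[0,T)$ exists, and let $$\mathcal D_e=\{u\in C_D([0,1]):\tau^u<+\infty\}$$ be the domain of explosion. Then the explosion time $u\mapsto\tau^u$ is continuous on $\mathcal D_e$. -/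

import Mathlib

open Set Filter Topology
open scoped ENNReal

noncomputable section

namespace ReactionDiffusion

/-- The space `C_D([0,1])` of continuous real functions on `[0,1]` vanishing at `0` and `1`. Its
metric is the one inherited from `C([0,1], ℝ)`, that is, the supremum distance. -/
abbrev DirichletData : Type :=
  {u : C(unitInterval, ℝ) // u 0 = 0 ∧ u 1 = 0}

/-- The source term `g(r) = r |r|^(p-1)`. -/
def source (p r : ℝ) : ℝ :=
  r * |r| ^ (p - 1)

/-- `U` (as `U t x`) is a solution on `[0,T) × [0,1]` of
`∂ₜ U = ∂²ₓₓ U + g(U)` for `0 < t < T`, `0 < x < 1`, with homogeneous Dirichlet boundary conditions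
and initial datum `u`: it is continuous on `[0,T) × [0,1]`, the derivatives that occur in the
equation exist at all interior points, and the equation holds there. Only the values of `U` on
`[0,T) × [0,1]` matter. -/
structure IsSolution (p : ℝ) (u : DirichletData) (T : ℝ) (U : ℝ → ℝ → ℝ) : Prop where
  continuousOn : ContinuousOn (fun q : ℝ × ℝ => U q.1 q.2) (Ico 0 T ×ˢ Icc 0 1)
  initial : ∀ x : unitInterval, U 0 x = u.1 x
  boundary_left : ∀ t ∈ Ico 0 T, U t 0 = 0
  boundary_right : ∀ t ∈ Ico 0 T, U t 1 = 0
  differentiableAt_time : ∀ t ∈ Ioo 0 T, ∀ x ∈ Ioo (0 : ℝ) 1,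
    DifferentiableAt ℝ (fun s => U s x) t
  differentiableAt_space : ∀ t ∈ Ioo 0 T, ∀ x ∈ Ioo (0 : ℝ) 1,
    DifferentiableAt ℝ (fun y => U t y) x
  differentiableAt_deriv_space : ∀ t ∈ Ioo 0 T, ∀ x ∈ Ioo (0 : ℝ) 1,
    DifferentiableAt ℝ (deriv fun y => U t y) x
  equation : ∀ t ∈ Ioo 0 T, ∀ x ∈ Ioo (0 : ℝ) 1,
    deriv (fun s => U s x) t = deriv (deriv fun y => U t y) x + source p (U t x)

/-- The explosion time `τ^u ∈ (0,∞]`: the supremum of all `T > 0` such that there is a solution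
with initial datum `u` on `[0,T)`. Since solutions are unique, this is the right end point of the
maximal interval of existence. -/
def explosionTime (p : ℝ) (u : DirichletData) : ℝ≥0∞ :=
  sSup {τ : ℝ≥0∞ | ∃ T : ℝ, 0 < T ∧ (∃ U : ℝ → ℝ → ℝ, IsSolution p u T U) ∧ τ = ENNReal.ofReal T}

/-- The domain of explosion `D_e`: the initial data whose solution explodes in finite time. -/
def explosionDomain (p : ℝ) : Set DirichletData :=
  {u | explosionTime p u < ∞}

end ReactionDiffusion

end

noncomputable section

namespace ReactionDiffusion

open MeasureTheory ProbabilityTheory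

/-! ### Periodic functions, translations and derivatives -/

/-! Lower semicontinuity of `explosionTime` is continuous dependence on the data. While the solution
from `u` stays below a level `M`, it coincides with the global solution `truncSol` of a problem
whose source is globally Lipschitz. That solution depends on the datum in a Lipschitz way, so nearby
data stay below `M` on the same interval (`IsGood.eventually`, `eventually_lt_explosionTime`).

Upper semicontinuity uses the energy `E(φ) = ½ ∫ φ'² - ∫ |φ|^(p+1)/(p+1)`, of which the equation is
the gradient flow: `E` decreases at the rate `∫ (∂ₜU)²` (`hasDerivAt_energy`). Three facts combine
in `eventually_explosionTime_lt`. (a) At a finite explosion time the energy is unbounded below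
(`exists_energy_lt`). Otherwise `∫ (∂ₜU)²` is integrable in time and `U` is bounded in `L²`. Then
`|U|^(p-1)` is at most a constant plus a multiple of `∫ (∂ₜU)²`, and Gronwall bounds `U` up to that
time (`exists_norm_le_of_energy`). (b) If the energy at time `t₁` is below a threshold depending
only on `ε` and `p`, the solution cannot last beyond `t₁ + ε`: by Jensen `∫ U²` satisfies a
superlinear differential inequality (`exists_energy_le_imp_le`). (c) At a fixed positive time the
energy is continuous in the datum, thanks to the smoothing of the heat semigroup
(`continuousAt_energy_truncSol`). Hence a very negative energy reached by `u` just before its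
explosion is shared by nearby data, which must then explode soon.

The Dirichlet problem becomes a 2-periodic one by odd reflection, and the heat semigroup is a
Gaussian average of translates. Mild solutions come from a contraction and are shown to be regular.
The maximum principle identifies them with the classical solutions that define `explosionTime`. -/

instance fact_two_pos : Fact ((0 : ℝ) < 2) := ⟨two_pos⟩

/-- Continuous `2`-periodic real functions, with the supremum norm. -/
abbrev Per : Type := C(AddCircle (2 : ℝ), ℝ)

/-- Translation of a periodic function. -/
def shift (y : ℝ) (φ : Per) : Per :=
  ⟨fun x => φ (x + (y : AddCircle (2 : ℝ))), by fun_prop⟩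

@[simp] lemma shift_apply (y : ℝ) (φ : Per) (x : AddCircle (2 : ℝ)) :
    shift y φ x = φ (x + (y : AddCircle (2 : ℝ))) := rfl

lemma continuous_shift : Continuous fun q : ℝ × Per => shift q.1 q.2 := by
  apply ContinuousMap.continuous_of_continuous_uncurry
  simp only [Function.uncurry_def, shift_apply]
  fun_prop

lemma norm_shift_le (y : ℝ) (φ : Per) : ‖shift y φ‖ ≤ ‖φ‖ :=
  (ContinuousMap.norm_le _ (norm_nonneg _)).2 fun _ => φ.norm_coe_le_norm _

@[simp] lemma shift_zero (φ : Per) : shift 0 φ = φ := by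
  ext x; simp

lemma shift_add (y : ℝ) (φ ψ : Per) : shift y (φ + ψ) = shift y φ + shift y ψ := rfl

lemma shift_smul (y c : ℝ) (φ : Per) : shift y (c • φ) = c • shift y φ := rfl

/-- `ψ` is the derivative of the periodic function `φ`. -/
def IsDer (φ ψ : Per) : Prop := ∀ x : ℝ, HasDerivAt (fun y : ℝ => φ y) (ψ x) x

lemma continuous_coe_apply (φ : Per) : Continuous fun x : ℝ => φ x :=
  φ.continuous.comp (AddCircle.continuous_mk' 2)

lemma IsDer.sub_eq {φ ψ : Per} (h : IsDer φ ψ) (a b : ℝ) :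
    φ b - φ a = ∫ x in a..b, ψ (x : ℝ) :=
  (intervalIntegral.integral_eq_sub_of_hasDerivAt (fun x _ => h x)
    ((continuous_coe_apply ψ).intervalIntegrable _ _)).symm

lemma isDer_of_sub_eq {φ ψ : Per} (h : ∀ b : ℝ, φ b - φ (0 : ℝ) = ∫ x in (0 : ℝ)..b, ψ (x : ℝ)) :
    IsDer φ ψ := by
  intro x
  have h1 : HasDerivAt (fun y : ℝ => (∫ x in (0 : ℝ)..y, ψ (x : ℝ)) + φ (0 : ℝ)) (ψ x) x :=
    (intervalIntegral.integral_hasDerivAt_right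
      ((continuous_coe_apply ψ).intervalIntegrable _ _)
      (continuous_coe_apply ψ).stronglyMeasurable.stronglyMeasurableAtFilter
      (continuous_coe_apply ψ).continuousAt).add_const _
  convert h1 using 1
  ext y
  rw [← h y]; ring

lemma coe_surj (x : AddCircle (2 : ℝ)) : ∃ y : ℝ, (y : AddCircle (2 : ℝ)) = x :=
  QuotientAddGroup.mk_surjective x

lemma IsDer.unique {φ ψ χ : Per} (h : IsDer φ ψ) (h' : IsDer φ χ) : ψ = χ := by
  ext x
  obtain ⟨y, rfl⟩ := coe_surj x
  exact (h y).unique (h' y)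

lemma IsDer.add {φ ψ φ' ψ' : Per} (h : IsDer φ ψ) (h' : IsDer φ' ψ') :
    IsDer (φ + φ') (ψ + ψ') := fun x => (h x).add (h' x)

lemma IsDer.smul {φ ψ : Per} (c : ℝ) (h : IsDer φ ψ) : IsDer (c • φ) (c • ψ) :=
  fun x => (h x).const_mul c

/-- The integral of a periodic function over an interval, as a continuous linear functional. -/
def integralCLM (a b : ℝ) : Per →L[ℝ] ℝ :=
  LinearMap.mkContinuous
    { toFun := fun φ => ∫ x in a..b, φ (x : ℝ)
      map_add' := fun φ ψ => by
        simpa using intervalIntegral.integral_add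
          ((continuous_coe_apply φ).intervalIntegrable (μ := volume) a b)
          ((continuous_coe_apply ψ).intervalIntegrable (μ := volume) a b)
      map_smul' := fun c φ => by simp } |b - a| fun φ => by
      rw [mul_comm]
      exact intervalIntegral.norm_integral_le_of_norm_le_const fun x _ => φ.norm_coe_le_norm _

lemma integralCLM_apply (a b : ℝ) (φ : Per) : integralCLM a b φ = ∫ x in a..b, φ (x : ℝ) := rfl

/-- Evaluation at a point, as a continuous linear functional. -/
def evalCLM (x : ℝ) : Per →L[ℝ] ℝ := ContinuousMap.evalCLM ℝ (x : AddCircle (2 : ℝ))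

lemma evalCLM_apply (x : ℝ) (φ : Per) : evalCLM x φ = φ (x : ℝ) := rfl

/-- The relation is tested in the integrated form of `isDer_of_sub_eq`, where it suffices to commute
bounded functionals with the integral in `s`. -/
lemma IsDer.integral {φ ψ : ℝ → Per} (hφ : Continuous φ) (hψ : Continuous ψ) {a b : ℝ}
    (h : ∀ s ∈ uIcc a b, IsDer (φ s) (ψ s)) :
    IsDer (∫ s in a..b, φ s) (∫ s in a..b, ψ s) := by
  apply isDer_of_sub_eq
  intro y
  rw [← integralCLM_apply, ← ContinuousLinearMap.intervalIntegral_comp_comm _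
    (hψ.intervalIntegrable _ _), ← evalCLM_apply, ← evalCLM_apply,
    ← ContinuousLinearMap.intervalIntegral_comp_comm _ (hφ.intervalIntegrable _ _),
    ← ContinuousLinearMap.intervalIntegral_comp_comm _ (hφ.intervalIntegrable _ _),
    ← intervalIntegral.integral_sub]
  · exact intervalIntegral.integral_congr fun s hs => (h s hs).sub_eq 0 y
  · exact ((evalCLM y).continuous.comp hφ).intervalIntegrable _ _
  · exact ((evalCLM 0).continuous.comp hφ).intervalIntegrable _ _

lemma IsDer.shift_sub_eq {φ ψ : Per} (h : IsDer φ ψ) (y : ℝ) :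
    shift y φ - φ = ∫ s in (0 : ℝ)..y, shift s ψ := by
  have hc : Continuous fun s : ℝ => shift s ψ := continuous_shift.comp (continuous_id.prodMk continuous_const)
  ext x
  obtain ⟨x, rfl⟩ := coe_surj x
  rw [← evalCLM_apply x (∫ s in (0 : ℝ)..y, shift s ψ),
    ← ContinuousLinearMap.intervalIntegral_comp_comm _ (hc.intervalIntegrable _ _)]
  have h1 := h.sub_eq x (x + y)
  have h2 : (∫ s in (0 : ℝ)..y, ψ ((x + s : ℝ) : AddCircle (2 : ℝ))) =
      ∫ s in x..(x + y), ψ (s : ℝ) := by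
    rw [intervalIntegral.integral_comp_add_left (fun s : ℝ => ψ (s : ℝ)) x, add_zero]
  simp only [AddCircle.coe_add] at h2
  simp only [ContinuousMap.sub_apply, shift_apply, evalCLM_apply, h2]
  simpa using h1

/-- Differentiability in the supremum norm, obtained from the vector-valued fundamental theorem of
calculus. -/
lemma IsDer.hasDerivAt_shift {φ ψ : Per} (h : IsDer φ ψ) (y : ℝ) :
    HasDerivAt (fun s => shift s φ) (shift y ψ) y := by
  have hc : Continuous fun s : ℝ => shift s ψ := continuous_shift.comp (continuous_id.prodMk continuous_const)
  have h1 : HasDerivAt (fun y : ℝ => (∫ s in (0 : ℝ)..y, shift s ψ) + φ) (shift y ψ) y :=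
    (intervalIntegral.integral_hasDerivAt_right (hc.intervalIntegrable _ _)
      hc.stronglyMeasurable.stronglyMeasurableAtFilter hc.continuousAt).add_const _
  convert h1 using 1
  ext1 y
  rw [← h.shift_sub_eq, sub_add_cancel]

/-! ### Gaussian averages of translates -/

/-- The standard Gaussian measure on the line. -/
def stdGaussian : Measure ℝ := gaussianReal 0 1

instance : IsProbabilityMeasure stdGaussian := by
  unfold stdGaussian; infer_instance

/-- The weighted Gaussian average of the translates `φ (· + σ z)`. -/
def gaussAvg (h : ℝ → ℝ) (σ : ℝ) (φ : Per) : Per :=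
  ∫ z, h z • shift (σ * z) φ ∂stdGaussian

lemma continuous_weight_shift {h : ℝ → ℝ} (hc : Continuous h) (σ : ℝ) (φ : Per) :
    Continuous fun z => h z • shift (σ * z) φ :=
  hc.smul (continuous_shift.comp (by fun_prop : Continuous fun z : ℝ => (σ * z, φ)))

lemma integrable_weight_shift {h : ℝ → ℝ} (hc : Continuous h)
    (hi : Integrable h stdGaussian) (σ : ℝ) (φ : Per) :
    Integrable (fun z => h z • shift (σ * z) φ) stdGaussian := by
  refine (hi.norm.mul_const ‖φ‖).mono' (continuous_weight_shift hc σ φ).aestronglyMeasurable ?_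
  refine Eventually.of_forall fun z => ?_
  rw [norm_smul]
  gcongr
  exact norm_shift_le _ _

lemma gaussAvg_apply {h : ℝ → ℝ} (hc : Continuous h)
    (hi : Integrable h stdGaussian) (σ : ℝ) (φ : Per) (x : AddCircle (2 : ℝ)) :
    gaussAvg h σ φ x = ∫ z, h z * φ (x + ((σ * z : ℝ) : AddCircle (2 : ℝ))) ∂stdGaussian := by
  rw [gaussAvg, ContinuousMap.integral_apply (integrable_weight_shift hc hi σ φ)]
  rfl

lemma norm_gaussAvg_le {h : ℝ → ℝ} (hi : Integrable h stdGaussian) (σ : ℝ) (φ : Per) :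
    ‖gaussAvg h σ φ‖ ≤ (∫ z, ‖h z‖ ∂stdGaussian) * ‖φ‖ := by
  rw [gaussAvg, ← integral_mul_const]
  refine norm_integral_le_of_norm_le (hi.norm.mul_const _) (Eventually.of_forall fun z => ?_)
  rw [norm_smul]
  gcongr
  exact norm_shift_le _ _

lemma gaussAvg_add {h : ℝ → ℝ} (hc : Continuous h)
    (hi : Integrable h stdGaussian) (σ : ℝ) (φ ψ : Per) :
    gaussAvg h σ (φ + ψ) = gaussAvg h σ φ + gaussAvg h σ ψ := by
  simp only [gaussAvg, shift_add, smul_add]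
  exact integral_add (integrable_weight_shift hc hi σ φ) (integrable_weight_shift hc hi σ ψ)

lemma gaussAvg_smul {h : ℝ → ℝ} (σ c : ℝ) (φ : Per) :
    gaussAvg h σ (c • φ) = c • gaussAvg h σ φ := by
  simp only [gaussAvg, shift_smul, smul_comm _ c]
  exact integral_smul _ _

lemma continuous_gaussAvg {h : ℝ → ℝ} (hc : Continuous h)
    (hi : Integrable h stdGaussian) : Continuous fun q : ℝ × Per => gaussAvg h q.1 q.2 := by
  rw [continuous_iff_continuousAt]
  rintro ⟨σ, φ⟩
  refine continuousAt_of_dominated (bound := fun z => ‖h z‖ * (‖φ‖ + 1))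
    (Eventually.of_forall fun q => (continuous_weight_shift hc q.1 q.2).aestronglyMeasurable)
    ?_ (hi.norm.mul_const _) (Eventually.of_forall fun z => ?_)
  · have : ∀ᶠ q : ℝ × Per in 𝓝 (σ, φ), ‖q.2‖ < ‖φ‖ + 1 :=
      (continuous_snd.norm.tendsto (σ, φ)).eventually_lt_const (by simp)
    filter_upwards [this] with q hq
    refine Eventually.of_forall fun z => ?_
    rw [norm_smul]
    gcongr
    exact (norm_shift_le _ _).trans hq.le
  · have h1 : Continuous fun q : ℝ × Per => shift (q.1 * z) q.2 :=
      continuous_shift.comp (by fun_prop : Continuous fun q : ℝ × Per => (q.1 * z, q.2))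
    exact (h1.const_smul (h z)).continuousAt

lemma integrable_id_stdGaussian : Integrable (fun z : ℝ => z) stdGaussian :=
  (memLp_id_gaussianReal (μ := 0) (v := 1) 1).integrable le_rfl

/-- The Gaussian average `φ ↦ ∫ φ (· + σ z) dγ(z)`. -/
def avg (σ : ℝ) : Per →L[ℝ] Per :=
  LinearMap.mkContinuous
    { toFun := gaussAvg (fun _ => 1) σ
      map_add' := gaussAvg_add continuous_const (integrable_const _) σ
      map_smul' := gaussAvg_smul σ } 1 fun φ => by
      simpa using norm_gaussAvg_le (h := fun _ => 1) (integrable_const _) σ φ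

/-- The first moment `φ ↦ ∫ z φ (· + σ z) dγ(z)`. -/
def moment (σ : ℝ) : Per →L[ℝ] Per :=
  LinearMap.mkContinuous
    { toFun := gaussAvg (fun z => z) σ
      map_add' := gaussAvg_add continuous_id integrable_id_stdGaussian σ
      map_smul' := gaussAvg_smul σ } (∫ z, ‖z‖ ∂stdGaussian) fun φ =>
      norm_gaussAvg_le (h := fun z => z) integrable_id_stdGaussian σ φ

lemma avg_eq (σ : ℝ) (φ : Per) : avg σ φ = ∫ z, shift (σ * z) φ ∂stdGaussian := by
  change gaussAvg _ _ _ = _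
  simp [gaussAvg]

lemma moment_eq (σ : ℝ) (φ : Per) : moment σ φ = ∫ z, z • shift (σ * z) φ ∂stdGaussian := rfl

lemma avg_apply (σ : ℝ) (φ : Per) (x : AddCircle (2 : ℝ)) :
    avg σ φ x = ∫ z, φ (x + ((σ * z : ℝ) : AddCircle (2 : ℝ))) ∂stdGaussian := by
  change gaussAvg _ _ _ _ = _
  simp [gaussAvg_apply continuous_const (integrable_const _)]

lemma moment_apply (σ : ℝ) (φ : Per) (x : AddCircle (2 : ℝ)) :
    moment σ φ x = ∫ z, z * φ (x + ((σ * z : ℝ) : AddCircle (2 : ℝ))) ∂stdGaussian :=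
  gaussAvg_apply continuous_id integrable_id_stdGaussian σ φ x

lemma integrable_shift (σ : ℝ) (φ : Per) :
    Integrable (fun z => shift (σ * z) φ) stdGaussian := by
  simpa using integrable_weight_shift (h := fun _ => 1) continuous_const (integrable_const _) σ φ

lemma integrable_smul_shift (σ : ℝ) (φ : Per) :
    Integrable (fun z => z • shift (σ * z) φ) stdGaussian :=
  integrable_weight_shift continuous_id integrable_id_stdGaussian σ φ

lemma norm_avg_le (σ : ℝ) (φ : Per) : ‖avg σ φ‖ ≤ ‖φ‖ := by
  change ‖gaussAvg _ _ _‖ ≤ _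
  simpa using norm_gaussAvg_le (h := fun _ => 1) (integrable_const _) σ φ

lemma norm_moment_le (σ : ℝ) (φ : Per) : ‖moment σ φ‖ ≤ (∫ z, ‖z‖ ∂stdGaussian) * ‖φ‖ :=
  norm_gaussAvg_le (h := fun z => z) integrable_id_stdGaussian σ φ

lemma continuous_avg : Continuous fun q : ℝ × Per => avg q.1 q.2 :=
  continuous_gaussAvg (h := fun _ => 1) continuous_const (integrable_const _)

lemma continuous_moment : Continuous fun q : ℝ × Per => moment q.1 q.2 :=
  continuous_gaussAvg (h := fun z => z) continuous_id integrable_id_stdGaussian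

@[simp] lemma avg_zero (φ : Per) : avg 0 φ = φ := by
  simp [avg_eq]

lemma integral_stdGaussian_id : ∫ z, z ∂stdGaussian = 0 := integral_id_gaussianReal

@[simp] lemma moment_zero (φ : Per) : moment 0 φ = 0 := by
  simp [moment_eq, integral_smul_const, integral_stdGaussian_id]

/-- Variances add under convolution of centred Gaussians. This is the source of the semigroup law
`heat_heat`. -/
lemma avg_avg (a b : ℝ) (φ : Per) : avg a (avg b φ) = avg √(a ^ 2 + b ^ 2) φ := by
  have key : (stdGaussian.map fun z => a * z) ∗ (stdGaussian.map fun z => b * z) =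
      stdGaussian.map fun z => √(a ^ 2 + b ^ 2) * z := by
    simp only [stdGaussian]
    rw [gaussianReal_map_const_mul, gaussianReal_map_const_mul, gaussianReal_map_const_mul,
      gaussianReal_conv_gaussianReal]
    congr 1
    · simp
    · ext
      simp [Real.sq_sqrt (add_nonneg (sq_nonneg a) (sq_nonneg b))]
  ext x
  have hm : ∀ c : ℝ, Measurable fun z : ℝ => c * z := fun c => measurable_const_mul c
  set f : ℝ → ℝ := fun y => φ (x + (y : AddCircle (2 : ℝ))) with hf
  have hfc : Continuous f := by
    exact φ.continuous.comp (continuous_const.add (AddCircle.continuous_mk' 2))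
  have hR : ∫ y, f y ∂((stdGaussian.map fun z => a * z) ∗ (stdGaussian.map fun z => b * z)) =
      avg √(a ^ 2 + b ^ 2) φ x := by
    rw [key, integral_map (hm _).aemeasurable hfc.aestronglyMeasurable, avg_apply]
  rw [← hR, Measure.conv, integral_map (by fun_prop) hfc.aestronglyMeasurable, integral_prod,
    integral_map (hm _).aemeasurable, avg_apply]
  · refine integral_congr_ae (Eventually.of_forall fun z => ?_)
    dsimp only
    rw [integral_map (hm _).aemeasurable (by
      exact (hfc.comp (by fun_prop)).aestronglyMeasurable), avg_apply]
    refine integral_congr_ae (Eventually.of_forall fun w => ?_)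
    simp [hf, add_assoc]
  · refine StronglyMeasurable.aestronglyMeasurable ?_
    refine StronglyMeasurable.integral_prod_right ?_
    exact (hfc.comp (by fun_prop)).stronglyMeasurable
  · have := Measure.isProbabilityMeasure_map (μ := stdGaussian) (hm a).aemeasurable
    have := Measure.isProbabilityMeasure_map (μ := stdGaussian) (hm b).aemeasurable
    refine Integrable.of_bound (C := ‖φ‖) (hfc.comp (by fun_prop)).aestronglyMeasurable
      (Eventually.of_forall fun z => φ.norm_coe_le_norm _)

lemma isDer_gaussAvg {h : ℝ → ℝ} (hc : Continuous h) (hi : Integrable h stdGaussian) {φ ψ : Per}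
    (hφ : IsDer φ ψ) (σ : ℝ) : IsDer (gaussAvg h σ φ) (gaussAvg h σ ψ) := by
  intro x
  simp only [gaussAvg_apply hc hi]
  have hcont : ∀ (χ : Per) (y : ℝ), Continuous fun z : ℝ =>
      h z * χ ((y : AddCircle (2 : ℝ)) + ((σ * z : ℝ) : AddCircle (2 : ℝ))) := fun χ y => by
    have : Continuous fun z : ℝ => χ ((y + σ * z : ℝ) : AddCircle (2 : ℝ)) :=
      (continuous_coe_apply χ).comp (by fun_prop)
    exact hc.mul (by simpa using this)
  have hbd : ∀ (χ : Per) (y z : ℝ),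
      ‖h z * χ ((y : AddCircle (2 : ℝ)) + ((σ * z : ℝ) : AddCircle (2 : ℝ)))‖ ≤ ‖h z‖ * ‖χ‖ :=
    fun χ y z => by
      rw [norm_mul]
      gcongr
      exact χ.norm_coe_le_norm _
  refine (hasDerivAt_integral_of_dominated_loc_of_deriv_le (s := univ) univ_mem
    (bound := fun z => ‖h z‖ * ‖ψ‖)
    (Eventually.of_forall fun y => (hcont φ y).aestronglyMeasurable)
    ((hi.norm.mul_const ‖φ‖).mono' (hcont φ x).aestronglyMeasurable
      (Eventually.of_forall fun z => hbd φ x z))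
    (hcont ψ x).aestronglyMeasurable
    (Eventually.of_forall fun z y _ => hbd ψ y z) (hi.norm.mul_const _)
    (Eventually.of_forall fun z y _ => ?_)).2
  have h1 := (hφ (y + σ * z)).comp_add_const y (σ * z)
  simpa using h1.const_mul (h z)

lemma IsDer.avg {φ ψ : Per} (hφ : IsDer φ ψ) (σ : ℝ) : IsDer (avg σ φ) (avg σ ψ) :=
  isDer_gaussAvg continuous_const (integrable_const _) hφ σ

lemma IsDer.moment {φ ψ : Per} (hφ : IsDer φ ψ) (σ : ℝ) : IsDer (moment σ φ) (moment σ ψ) :=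
  isDer_gaussAvg continuous_id integrable_id_stdGaussian hφ σ

lemma integral_stdGaussian (f : ℝ → ℝ) :
    ∫ z, f z ∂stdGaussian = ∫ z, gaussianPDFReal 0 1 z * f z := by
  simpa [stdGaussian] using
    integral_gaussianReal_eq_integral_smul (μ := 0) (v := 1) (f := f) one_ne_zero

lemma gaussianPDFReal_std (z : ℝ) :
    gaussianPDFReal 0 1 z = (√(2 * Real.pi))⁻¹ * Real.exp (-z ^ 2 / 2) := by
  simp [gaussianPDFReal]

lemma hasDerivAt_gaussianPDFReal_std (z : ℝ) :
    HasDerivAt (gaussianPDFReal 0 1) (-z * gaussianPDFReal 0 1 z) z := by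
  have h1 : HasDerivAt (fun z : ℝ => -z ^ 2 / 2) (-z) z := by
    refine (((hasDerivAt_pow 2 z).neg).div_const 2).congr_deriv ?_
    simp only [Nat.cast_ofNat, Nat.add_one_sub_one, pow_one]
    ring
  have h2 := (h1.exp).const_mul (√(2 * Real.pi))⁻¹
  have h3 : gaussianPDFReal 0 1 = fun z => (√(2 * Real.pi))⁻¹ * Real.exp (-z ^ 2 / 2) :=
    funext gaussianPDFReal_std
  rw [h3]
  refine h2.congr_deriv ?_
  ring

/-- A domination uniform in `|v| ≤ 1`, for differentiating under the integral sign: `-(z - v)² / 2 ≤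
-z² / 2 + |z|`. -/
lemma gaussianPDFReal_std_sub_le {z v : ℝ} (hv : |v| ≤ 1) :
    gaussianPDFReal 0 1 (z - v) ≤ gaussianPDFReal 0 1 z * (Real.exp z + Real.exp (-z)) := by
  rw [gaussianPDFReal_std, gaussianPDFReal_std, mul_assoc]
  gcongr
  have h1 : -(z - v) ^ 2 / 2 ≤ -z ^ 2 / 2 + |z| := by
    have : z * v ≤ |z| := by
      calc z * v ≤ |z * v| := le_abs_self _
        _ = |z| * |v| := abs_mul _ _
        _ ≤ |z| * 1 := by gcongr
        _ = |z| := mul_one _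
    nlinarith [sq_nonneg v]
  calc Real.exp (-(z - v) ^ 2 / 2) ≤ Real.exp (-z ^ 2 / 2 + |z|) := Real.exp_le_exp.2 h1
    _ = Real.exp (-z ^ 2 / 2) * Real.exp |z| := Real.exp_add _ _
    _ ≤ _ := by
      gcongr
      rcases abs_cases z with ⟨h, _⟩ | ⟨h, _⟩ <;> rw [h] <;> linarith [Real.exp_pos z, Real.exp_pos (-z)]

/-- Differentiating a Gaussian average in a translation parameter produces the first moment. -/
lemma hasDerivAt_integral_stdGaussian_add {f : ℝ → ℝ} (hf : Continuous f) {C : ℝ}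
    (hC : ∀ x, |f x| ≤ C) :
    HasDerivAt (fun v => ∫ z, f (z + v) ∂stdGaussian) (∫ z, z * f z ∂stdGaussian) 0 := by
  have hρ : Continuous (gaussianPDFReal 0 1) := by
    have : gaussianPDFReal 0 1 = fun z => (√(2 * Real.pi))⁻¹ * Real.exp (-z ^ 2 / 2) :=
      funext gaussianPDFReal_std
    rw [this]; fun_prop
  -- Since `f` is only continuous, the parameter is moved onto the smooth density.
  have h0 : ∀ v, ∫ z, f (z + v) ∂stdGaussian = ∫ z, gaussianPDFReal 0 1 (z - v) * f z := by
    intro v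
    rw [integral_stdGaussian, ← integral_sub_right_eq_self
      (fun z => gaussianPDFReal 0 1 z * f (z + v)) v]
    simp
  have hC0 : 0 ≤ C := (abs_nonneg _).trans (hC 0)
  have hint : ∀ g : ℝ → ℝ, Continuous g → Integrable g stdGaussian →
      Integrable (fun z => gaussianPDFReal 0 1 z * g z) := by
    intro g _ hg
    have h1 : stdGaussian = volume.withDensity (gaussianPDF 0 1) :=
      gaussianReal_of_var_ne_zero 0 one_ne_zero
    rw [h1, integrable_withDensity_iff_integrable_smul₀' (measurable_gaussianPDF 0 1).aemeasurable
      (Eventually.of_forall fun z => gaussianPDF_lt_top)] at hg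
    simpa using hg
  have hexp : Integrable (fun z => (|z| + 1) * (Real.exp z + Real.exp (-z)) * C) stdGaussian := by
    have hle : ∀ z : ℝ, |z| + 1 ≤ Real.exp z + Real.exp (-z) := by
      intro z
      rcases abs_cases z with ⟨h, h'⟩ | ⟨h, h'⟩ <;> rw [h]
      · linarith [Real.add_one_le_exp z, Real.exp_pos (-z)]
      · linarith [Real.add_one_le_exp (-z), Real.exp_pos z]
    have h2 : ∀ t : ℝ, Integrable (fun z => Real.exp (t * z)) stdGaussian :=
      fun t => integrable_exp_mul_gaussianReal t
    -- As `|z| + 1 ≤ exp z + exp (-z)`, the function is dominated by `C` times the square of that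
    -- sum, expanded here.
    refine Integrable.mono' (g := fun z => (Real.exp (2 * z) + 2 + Real.exp (-2 * z)) * C)
      ((((h2 2).add (integrable_const _)).add (h2 (-2))).mul_const _)
      (by fun_prop) (Eventually.of_forall fun z => ?_)
    have h3 : Real.exp (2 * z) = Real.exp z * Real.exp z := by rw [← Real.exp_add]; ring_nf
    have h4 : Real.exp (-2 * z) = Real.exp (-z) * Real.exp (-z) := by rw [← Real.exp_add]; ring_nf
    have h5 : Real.exp z * Real.exp (-z) = 1 := by rw [← Real.exp_add]; simp
    rw [Real.norm_of_nonneg (by positivity)]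
    gcongr
    calc (|z| + 1) * (Real.exp z + Real.exp (-z))
        ≤ (Real.exp z + Real.exp (-z)) * (Real.exp z + Real.exp (-z)) :=
          mul_le_mul_of_nonneg_right (hle z) (by positivity)
      _ = _ := by rw [h3, h4]; linear_combination 2 * h5
  simp only [h0]
  have hmain := (hasDerivAt_integral_of_dominated_loc_of_deriv_le (s := Metric.ball (0 : ℝ) 1)
    (μ := volume) (x₀ := (0 : ℝ)) (Metric.ball_mem_nhds _ one_pos)
    (F := fun v z => gaussianPDFReal 0 1 (z - v) * f z)
    (F' := fun v z => (z - v) * gaussianPDFReal 0 1 (z - v) * f z)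
    (bound := fun z => gaussianPDFReal 0 1 z * ((|z| + 1) * (Real.exp z + Real.exp (-z)) * C))
    (Eventually.of_forall fun v =>
      ((hρ.comp (by fun_prop)).mul hf).aestronglyMeasurable) ?_ ?_ ?_ (hint _ (by fun_prop) hexp)
      ?_).2
  · refine hmain.congr_deriv ?_
    rw [integral_stdGaussian]
    refine integral_congr_ae (Eventually.of_forall fun z => ?_)
    simp only [sub_zero]
    ring
  · simp only [sub_zero]
    exact hint f hf ((integrable_const C).mono' hf.aestronglyMeasurable (Eventually.of_forall hC))
  · exact (((by fun_prop : Continuous fun z : ℝ => z - 0).mul (hρ.comp (by fun_prop))).mul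
      hf).aestronglyMeasurable
  · refine Eventually.of_forall fun z v hv => ?_
    rw [mem_ball_zero_iff, Real.norm_eq_abs] at hv
    have h1 := gaussianPDFReal_std_sub_le (z := z) hv.le
    have h2 : |z - v| ≤ |z| + 1 := (abs_sub _ _).trans (by linarith)
    rw [norm_mul, norm_mul, Real.norm_eq_abs, Real.norm_eq_abs, Real.norm_eq_abs,
      abs_of_nonneg (gaussianPDFReal_nonneg 0 1 (z - v))]
    calc |z - v| * gaussianPDFReal 0 1 (z - v) * |f z|
        ≤ (|z| + 1) * (gaussianPDFReal 0 1 z * (Real.exp z + Real.exp (-z))) * C := by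
          have h3 := gaussianPDFReal_nonneg 0 1 z
          have h4 := gaussianPDFReal_nonneg 0 1 (z - v)
          gcongr
          exact hC z
      _ = _ := by ring
  · refine Eventually.of_forall fun z v _ => ?_
    have h1 := ((hasDerivAt_gaussianPDFReal_std (z - v)).comp_const_sub z v).mul_const (f z)
    refine h1.congr_deriv ?_
    ring

/-- The smoothing effect, with no differentiability of `φ`: a translation in `x` is a translation in
`z` by a multiple `1 / σ`. Keeping the factor `σ` on the left makes the relation survive at `σ = 0`,
which later removes the singularity of the Duhamel kernel. -/
lemma isDer_smul_avg (σ : ℝ) (φ : Per) : IsDer (σ • avg σ φ) (moment σ φ) := by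
  rcases eq_or_ne σ 0 with rfl | hσ
  · simp only [zero_smul, moment_zero]
    intro x
    simpa using hasDerivAt_const x (0 : ℝ)
  intro x
  set f : ℝ → ℝ := fun z => φ ((x + σ * z : ℝ) : AddCircle (2 : ℝ)) with hf
  have hfc : Continuous f := (continuous_coe_apply φ).comp (by fun_prop)
  have h1 := hasDerivAt_integral_stdGaussian_add hfc (C := ‖φ‖) fun z => φ.norm_coe_le_norm _
  have h2 : HasDerivAt (fun y : ℝ => (y - x) / σ) (1 / σ) x :=
    ((hasDerivAt_id x).sub_const x).div_const σ
  have h3 : HasDerivAt (fun y : ℝ => ∫ z, f (z + (y - x) / σ) ∂stdGaussian)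
      ((∫ z, z * f z ∂stdGaussian) * (1 / σ)) x := by
    refine HasDerivAt.comp x (h₂ := fun v => ∫ z, f (z + v) ∂stdGaussian) ?_ h2
    simpa using h1
  refine ((h3.const_mul σ).congr_deriv ?_).congr_of_eventuallyEq (Eventually.of_forall fun y => ?_)
  · rw [moment_apply]
    field_simp
    simp [hf]
  · simp only [ContinuousMap.smul_apply, avg_apply, smul_eq_mul, hf]
    congr 1
    refine integral_congr_ae (Eventually.of_forall fun z => ?_)
    dsimp only
    rw [← AddCircle.coe_add]
    congr 2
    field_simp
    ring

/-- Gaussian integration by parts, read off from the uniqueness of derivatives. -/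
lemma IsDer.moment_eq_smul_avg {φ ψ : Per} (h : IsDer φ ψ) (σ : ℝ) :
    ReactionDiffusion.moment σ φ = σ • ReactionDiffusion.avg σ ψ :=
  (isDer_smul_avg σ φ).unique ((h.avg σ).smul σ)

lemma IsDer.hasDerivAt_avg {φ ψ : Per} (h : IsDer φ ψ) (σ : ℝ) :
    HasDerivAt (fun s => ReactionDiffusion.avg s φ) (ReactionDiffusion.moment σ ψ) σ := by
  simp only [avg_eq, ReactionDiffusion.moment_eq]
  refine (hasDerivAt_integral_of_dominated_loc_of_deriv_le (s := univ) univ_mem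
    (F' := fun s z => z • shift (s * z) ψ) (bound := fun z => ‖z‖ * ‖ψ‖) (Eventually.of_forall fun s => (integrable_shift s φ).1)
    (integrable_shift σ φ) (integrable_smul_shift σ ψ).1
    (Eventually.of_forall fun z s _ => ?_) (integrable_id_stdGaussian.norm.mul_const _)
    (Eventually.of_forall fun z s _ => ?_)).2
  · rw [norm_smul]
    gcongr
    exact norm_shift_le _ _
  · have h1 : HasDerivAt (fun s : ℝ => s * z) z s := by
      simpa using (hasDerivAt_id s).mul_const z
    exact (h.hasDerivAt_shift (s * z)).scomp s h1

/-! ### The heat semigroup -/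

/-- The heat semigroup on periodic functions. It is the identity for `t ≤ 0`. -/
def heat (t : ℝ) : Per →L[ℝ] Per := avg √(2 * t)

lemma continuous_heat : Continuous fun q : ℝ × Per => heat q.1 q.2 :=
  continuous_avg.comp (by fun_prop : Continuous fun q : ℝ × Per => (√(2 * q.1), q.2))

lemma continuous_heat_apply (φ : Per) : Continuous fun s : ℝ => heat s φ :=
  continuous_heat.comp (by fun_prop : Continuous fun s : ℝ => (s, φ))

lemma norm_heat_le (t : ℝ) (φ : Per) : ‖heat t φ‖ ≤ ‖φ‖ := norm_avg_le _ _

@[simp] lemma heat_zero (φ : Per) : heat 0 φ = φ := by simp [heat]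

lemma heat_heat {s t : ℝ} (hs : 0 ≤ s) (ht : 0 ≤ t) (φ : Per) :
    heat s (heat t φ) = heat (s + t) φ := by
  rw [heat, heat, heat, avg_avg, Real.sq_sqrt (by positivity), Real.sq_sqrt (by positivity),
    mul_add]

/-- The space derivative of the heat semigroup, for `t > 0`. -/
def heatGrad (t : ℝ) : Per →L[ℝ] Per := (√(2 * t))⁻¹ • moment √(2 * t)

lemma isDer_heat {t : ℝ} (ht : 0 < t) (φ : Per) : IsDer (heat t φ) (heatGrad t φ) := by
  have h0 : √(2 * t) ≠ 0 := (Real.sqrt_pos.2 (by positivity)).ne'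
  have h1 := (isDer_smul_avg √(2 * t) φ).smul (√(2 * t))⁻¹
  rwa [inv_smul_smul₀ h0] at h1

lemma continuousOn_heatGrad (φ : Per) : ContinuousOn (fun t => heatGrad t φ) (Ioi 0) := by
  refine ContinuousOn.smul (ContinuousOn.inv₀
    (by fun_prop : Continuous fun t : ℝ => √(2 * t)).continuousOn fun t ht => ?_) ?_
  · exact (Real.sqrt_pos.2 (by have : 0 < t := ht; positivity)).ne'
  · exact (continuous_moment.comp
      (by fun_prop : Continuous fun t : ℝ => (√(2 * t), φ))).continuousOn

/-- The chain rule for `√(2s)` produces `moment √(2s) ψ` divided by `√(2s)`. Integration by parts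
rewrites it as `heat s χ`, so the factor singular at `s = 0` cancels. -/
lemma heat_sub_eq_integral {φ ψ χ : Per} (h : IsDer φ ψ) (h' : IsDer ψ χ) {t : ℝ} (ht : 0 ≤ t) :
    heat t φ - φ = ∫ s in (0 : ℝ)..t, heat s χ := by
  have hc := continuous_heat_apply χ
  have hc' := continuous_heat_apply φ
  have hd : ∀ s ∈ Ioo 0 t, HasDerivWithinAt (fun s => heat s φ) (heat s χ) (Ioi s) s := by
    intro s hs
    have hs0 : (0 : ℝ) < 2 * s := by linarith [hs.1]
    have h1 : HasDerivAt (fun s : ℝ => √(2 * s)) (1 / √(2 * s)) s := by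
      refine (((hasDerivAt_id s).const_mul 2).sqrt (by simpa using hs0.ne')).congr_deriv ?_
      simp; field_simp
    have h2 := (h.hasDerivAt_avg √(2 * s)).scomp s h1
    rw [h'.moment_eq_smul_avg, smul_smul, one_div_mul_cancel (Real.sqrt_pos.2 hs0).ne',
      one_smul] at h2
    exact h2.hasDerivWithinAt
  rw [intervalIntegral.integral_eq_sub_of_hasDeriv_right_of_le ht hc'.continuousOn hd
    (hc.intervalIntegrable _ _), heat_zero]

/-! ### Reflection -/

/-- The odd reflection `φ ↦ -φ(-·)`. -/
def reflect (φ : Per) : Per := ⟨fun x => -φ (-x), by fun_prop⟩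

@[simp] lemma reflect_apply (φ : Per) (x : AddCircle (2 : ℝ)) : reflect φ x = -φ (-x) := rfl

lemma continuous_reflect : Continuous reflect := by
  apply ContinuousMap.continuous_of_continuous_uncurry
  simp only [Function.uncurry_def, reflect_apply]
  fun_prop

lemma norm_reflect_le (φ : Per) : ‖reflect φ‖ ≤ ‖φ‖ := by
  refine (ContinuousMap.norm_le _ (norm_nonneg _)).2 fun x => ?_
  rw [reflect_apply, norm_neg]
  exact φ.norm_coe_le_norm _

/-- The odd reflection as a continuous linear map. -/
def reflectCLM : Per →L[ℝ] Per :=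
  { toFun := reflect
    map_add' := fun φ ψ => by ext x; simp; ring
    map_smul' := fun c φ => by ext x; simp
    cont := continuous_reflect }

lemma reflect_avg (σ : ℝ) (φ : Per) : reflect (avg σ φ) = avg σ (reflect φ) := by
  ext x
  rw [reflect_apply, avg_apply, avg_apply]
  have h1 : stdGaussian.map (fun z => -z) = stdGaussian := by
    simp [stdGaussian, gaussianReal_map_neg]
  have hc : Continuous fun z : ℝ => φ (-x + ((σ * z : ℝ) : AddCircle (2 : ℝ))) :=
    φ.continuous.comp (continuous_const.add
      ((AddCircle.continuous_mk' 2).comp (continuous_const.mul continuous_id)))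
  conv_lhs => rw [← h1]
  rw [integral_map (by fun_prop) hc.aestronglyMeasurable, ← integral_neg]
  refine integral_congr_ae (Eventually.of_forall fun z => ?_)
  simp [add_comm]

lemma reflect_heat (t : ℝ) (φ : Per) : reflect (heat t φ) = heat t (reflect φ) := reflect_avg _ _

/-! ### The Duhamel integral -/

/-- The Duhamel integral `∫₀ᵗ S(t-s) f(s) ds`. -/
def duhamel (f : ℝ → Per) (t : ℝ) : Per := ∫ s in (0 : ℝ)..t, heat (t - s) (f s)

/-- The space derivative of the Duhamel integral, after the substitution `s = t - σ²/2`, which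
removes the singularity of the kernel. -/
def duhamelGrad (f : ℝ → Per) (t : ℝ) : Per :=
  ∫ σ in (0 : ℝ)..√(2 * t), moment σ (f (t - σ ^ 2 / 2))

lemma continuous_heat_comp {X : Type*} [TopologicalSpace X] {a : X → ℝ} {f : X → Per}
    (ha : Continuous a) (hf : Continuous f) : Continuous fun x => heat (a x) (f x) :=
  continuous_heat.comp (ha.prodMk hf)

lemma continuous_moment_comp {X : Type*} [TopologicalSpace X] {a : X → ℝ} {f : X → Per}
    (ha : Continuous a) (hf : Continuous f) : Continuous fun x => moment (a x) (f x) :=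
  continuous_moment.comp (ha.prodMk hf)

lemma continuous_avg_comp {X : Type*} [TopologicalSpace X] {a : X → ℝ} {f : X → Per}
    (ha : Continuous a) (hf : Continuous f) : Continuous fun x => avg (a x) (f x) :=
  continuous_avg.comp (ha.prodMk hf)

lemma continuous_duhamel {f : ℝ → Per} (hf : Continuous f) : Continuous (duhamel f) := by
  refine intervalIntegral.continuous_parametric_intervalIntegral_of_continuous
    (f := fun t s => heat (t - s) (f s)) ?_ continuous_id
  exact continuous_heat_comp (continuous_fst.sub continuous_snd) (hf.comp continuous_snd)

lemma continuous_duhamelGrad {f : ℝ → Per} (hf : Continuous f) :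
    Continuous (duhamelGrad f) := by
  refine intervalIntegral.continuous_parametric_intervalIntegral_of_continuous
    (f := fun t σ => moment σ (f (t - σ ^ 2 / 2))) ?_ (by fun_prop)
  exact continuous_moment_comp continuous_snd (hf.comp (by fun_prop))

/-- The substitution `s = t - σ² / 2` has Jacobian `σ`, exactly the factor that `isDer_smul_avg`
needs in order to differentiate in space without a singular kernel. -/
lemma duhamel_eq {f : ℝ → Per} (hf : Continuous f) {t : ℝ} (ht : 0 ≤ t) :
    duhamel f t = ∫ σ in (0 : ℝ)..√(2 * t), σ • avg σ (f (t - σ ^ 2 / 2)) := by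
  have hc : Continuous fun s => heat (t - s) (f s) :=
    continuous_heat_comp (by fun_prop) hf
  have h1 : ∀ σ ∈ uIcc 0 √(2 * t), HasDerivAt (fun σ : ℝ => t - σ ^ 2 / 2) (-σ) σ := by
    intro σ _
    refine (((hasDerivAt_pow 2 σ).div_const 2).const_sub t).congr_deriv ?_
    simp only [Nat.cast_ofNat, Nat.add_one_sub_one, pow_one]
    ring
  have h2 := intervalIntegral.integral_deriv_smul_comp h1 (by fun_prop) hc
  have h3 : t - √(2 * t) ^ 2 / 2 = 0 := by rw [Real.sq_sqrt (by positivity)]; ring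
  rw [h3] at h2
  simp only [ne_eq, OfNat.ofNat_ne_zero, not_false_eq_true, zero_pow, zero_div, sub_zero] at h2
  rw [duhamel, intervalIntegral.integral_symm, ← h2, ← intervalIntegral.integral_neg]
  refine intervalIntegral.integral_congr fun σ hσ => ?_
  rw [uIcc_of_le (Real.sqrt_nonneg _)] at hσ
  simp only [Function.comp, heat, neg_smul, neg_neg, sub_sub_cancel]
  congr 2
  rw [mul_div_cancel₀ _ (two_ne_zero), Real.sqrt_sq hσ.1]

lemma isDer_duhamel {f : ℝ → Per} (hf : Continuous f) {t : ℝ} (ht : 0 ≤ t) :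
    IsDer (duhamel f t) (duhamelGrad f t) := by
  rw [duhamel_eq hf ht]
  have h1 : Continuous fun σ : ℝ => f (t - σ ^ 2 / 2) := hf.comp (by fun_prop)
  exact IsDer.integral (continuous_id.smul (continuous_avg_comp continuous_id h1))
    (continuous_moment_comp continuous_id h1) fun σ _ => isDer_smul_avg _ _

lemma isDer_duhamelGrad {f g : ℝ → Per} (hf : Continuous f) (hg : Continuous g)
    (h : ∀ s, IsDer (f s) (g s)) (t : ℝ) :
    IsDer (duhamelGrad f t) (duhamelGrad g t) :=
  IsDer.integral (continuous_moment_comp continuous_id (hf.comp (by fun_prop)))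
    (continuous_moment_comp continuous_id (hg.comp (by fun_prop)))
    fun σ _ => (h _).moment σ

lemma norm_duhamel_le (f : ℝ → Per) {t : ℝ} (hf : ContinuousOn f (Icc 0 t)) (ht : 0 ≤ t) :
    ‖duhamel f t‖ ≤ ∫ s in (0 : ℝ)..t, ‖f s‖ :=
  intervalIntegral.norm_integral_le_of_norm_le ht
    (Eventually.of_forall fun _ _ => norm_heat_le _ _)
    (hf.norm.intervalIntegrable_of_Icc ht)

lemma norm_duhamelGrad_le {f : ℝ → Per} {t B : ℝ} (ht : 0 ≤ t)
    (hB : ∀ s ∈ Icc 0 t, ‖f s‖ ≤ B) :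
    ‖duhamelGrad f t‖ ≤ (∫ z, ‖z‖ ∂stdGaussian) * B * √(2 * t) := by
  refine (intervalIntegral.norm_integral_le_of_norm_le_const
    (C := (∫ z, ‖z‖ ∂stdGaussian) * B) fun σ hσ => ?_).trans ?_
  · rw [uIoc_of_le (Real.sqrt_nonneg _)] at hσ
    refine (norm_moment_le _ _).trans ?_
    have h0 : (0 : ℝ) ≤ ∫ z, ‖z‖ ∂stdGaussian := integral_nonneg fun z => norm_nonneg _
    refine mul_le_mul_of_nonneg_left (hB _ ⟨?_, ?_⟩) h0
    · have : σ ^ 2 ≤ 2 * t := by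
        rw [← Real.sq_sqrt (by positivity : 0 ≤ 2 * t)]
        exact pow_le_pow_left₀ hσ.1.le hσ.2 2
      linarith
    · nlinarith [sq_nonneg σ]
  · rw [sub_zero, abs_of_nonneg (Real.sqrt_nonneg _)]

lemma duhamel_congr {f g : ℝ → Per} {t : ℝ} (ht : 0 ≤ t) (h : ∀ s ∈ Icc 0 t, f s = g s) :
    duhamel f t = duhamel g t :=
  intervalIntegral.integral_congr fun s hs => by
    rw [uIcc_of_le ht] at hs
    simp [h s hs]

lemma duhamel_add {f : ℝ → Per} (hf : Continuous f) {a h : ℝ} (ha : 0 ≤ a) (hh : 0 ≤ h) :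
    duhamel f (a + h) = heat h (duhamel f a) + duhamel (fun s => f (a + s)) h := by
  have hc : ∀ t, Continuous fun s => heat (t - s) (f s) := fun t =>
    continuous_heat_comp (by fun_prop) hf
  rw [duhamel, ← intervalIntegral.integral_add_adjacent_intervals (b := a)
    ((hc _).intervalIntegrable _ _) ((hc _).intervalIntegrable _ _)]
  congr 1
  · rw [duhamel, ← ContinuousLinearMap.intervalIntegral_comp_comm _
      ((hc _).intervalIntegrable _ _)]
    refine intervalIntegral.integral_congr fun s hs => ?_
    rw [uIcc_of_le ha] at hs
    rw [heat_heat hh (by linarith [hs.2])]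
    congr 2; ring
  · have h1 := intervalIntegral.integral_comp_add_left (a := 0) (b := h)
      (fun s => heat (a + h - s) (f s)) a
    rw [add_zero] at h1
    rw [← h1, duhamel]
    simp only [add_sub_add_left_eq_sub]

/-- By joint continuity the integrand is uniformly close to `f 0` for small times. The right
derivative at the origin is enough, because restarting moves any time to the origin. -/
lemma hasDerivWithinAt_duhamel_zero {f : ℝ → Per} (hf : Continuous f) :
    HasDerivWithinAt (duhamel f) (f 0) (Ici 0) 0 := by
  rw [hasDerivWithinAt_iff_isLittleO, Asymptotics.isLittleO_iff]
  intro ε hε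
  have hc : Continuous fun q : ℝ × ℝ => heat q.1 (f q.2) :=
    continuous_heat_comp continuous_fst (hf.comp continuous_snd)
  obtain ⟨δ, hδ, hδ'⟩ := Metric.continuousAt_iff.1 (hc.continuousAt (x := (0, 0))) ε hε
  have : ∀ᶠ h : ℝ in 𝓝[≥] 0, h < δ := nhdsWithin_le_nhds (gt_mem_nhds hδ)
  filter_upwards [this, self_mem_nhdsWithin] with h hh hh0
  have hh0 : 0 ≤ h := hh0
  have hc' : Continuous fun s => heat (h - s) (f s) := continuous_heat_comp (by fun_prop) hf
  have h1 : duhamel f h - duhamel f 0 - (h - 0) • f 0 =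
      ∫ s in (0 : ℝ)..h, (heat (h - s) (f s) - f 0) := by
    rw [intervalIntegral.integral_sub (hc'.intervalIntegrable _ _) (by simp)]
    simp [duhamel]
  rw [h1]
  have h2 : ∀ s ∈ uIoc 0 h, ‖heat (h - s) (f s) - f 0‖ ≤ ε := by
    intro s hs
    rw [uIoc_of_le hh0] at hs
    have := hδ' (x := (h - s, s)) (by
      rw [Prod.dist_eq, Real.dist_eq, Real.dist_eq]
      simp only [sub_zero, sup_lt_iff]
      rw [abs_of_nonneg (by linarith [hs.2]), abs_of_pos hs.1]
      exact ⟨by linarith [hs.1], by linarith [hs.2]⟩)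
    simpa [dist_eq_norm] using this.le
  simpa using intervalIntegral.norm_integral_le_of_norm_le_const h2

lemma norm_duhamel_le_exp {f : ℝ → Per} {B l t : ℝ} (hl : 0 < l) (ht : 0 ≤ t) (hB0 : 0 ≤ B)
    (hB : ∀ s ∈ Icc 0 t, ‖f s‖ ≤ B * Real.exp (l * s)) :
    ‖duhamel f t‖ ≤ B / l * Real.exp (l * t) := by
  have h1 : ‖duhamel f t‖ ≤ ∫ s in (0 : ℝ)..t, B * Real.exp (l * s) := by
    refine intervalIntegral.norm_integral_le_of_norm_le ht
      (Eventually.of_forall fun s hs => (norm_heat_le _ _).trans (hB s ⟨hs.1.le, hs.2⟩))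
      (Continuous.intervalIntegrable (by fun_prop) _ _)
  refine h1.trans ?_
  rw [intervalIntegral.integral_const_mul, intervalIntegral.integral_comp_mul_left _ hl.ne',
    integral_exp, smul_eq_mul]
  have : B * (l⁻¹ * (Real.exp (l * t) - Real.exp (l * 0))) =
      B / l * Real.exp (l * t) - B / l := by
    rw [mul_zero, Real.exp_zero]; field_simp
  rw [this]
  have : 0 ≤ B / l := by positivity
  linarith

/-! ### Global mild solutions for a globally Lipschitz source -/

/-- An odd, continuously differentiable nonlinearity with bounded derivative. -/
structure IsTame (F F' : C(ℝ, ℝ)) (L : ℝ) : Prop where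
  pos : 0 < L
  hasDerivAt : ∀ r, HasDerivAt F (F' r) r
  bound : ∀ r, |F' r| ≤ L
  odd : ∀ r, F (-r) = -F r

namespace IsTame

lemma abs_sub_le {F F' : C(ℝ, ℝ)} {L : ℝ} (hF : IsTame F F' L)
    (r s : ℝ) : |F r - F s| ≤ L * |r - s| := by
  have := Convex.norm_image_sub_le_of_norm_hasDerivWithin_le (s := univ) (f := F) (f' := F')
    (C := L) (x := s) (y := r) (fun x _ => (hF.hasDerivAt x).hasDerivWithinAt)
    (fun x _ => hF.bound x) convex_univ (mem_univ _) (mem_univ _)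
  simpa using this

lemma zero {F F' : C(ℝ, ℝ)} {L : ℝ} (hF : IsTame F F' L) : F 0 = 0 := by
  have := hF.odd 0
  rw [neg_zero] at this
  linarith

lemma norm_comp_sub_le {F F' : C(ℝ, ℝ)} {L : ℝ} (hF : IsTame F F' L)
    (φ ψ : Per) : ‖F.comp φ - F.comp ψ‖ ≤ L * ‖φ - ψ‖ := by
  refine (ContinuousMap.norm_le _ (mul_nonneg hF.pos.le (norm_nonneg _))).2 fun x => ?_
  refine (hF.abs_sub_le _ _).trans (mul_le_mul_of_nonneg_left ?_ hF.pos.le)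
  exact (φ - ψ).norm_coe_le_norm x

lemma norm_comp_le {F F' : C(ℝ, ℝ)} {L : ℝ} (hF : IsTame F F' L)
    (φ : Per) : ‖F.comp φ‖ ≤ L * ‖φ‖ := by
  have h := hF.norm_comp_sub_le φ 0
  have h0 : F.comp (0 : Per) = 0 := by ext x; simp [hF.zero]
  simpa [h0] using h

end IsTame

/-- `u` is a mild solution with initial datum `φ`, with controlled growth. -/
structure IsMild (F : C(ℝ, ℝ)) (l : ℝ) (φ : Per) (u : ℝ → Per) : Prop where
  continuous : Continuous u
  eq : ∀ t, 0 ≤ t → u t = heat t φ + duhamel (fun s => F.comp (u s)) t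
  growth : ∃ K, ∀ t, 0 ≤ t → ‖u t‖ ≤ K * Real.exp (l * t)

lemma continuous_comp_left (F : C(ℝ, ℝ)) {u : ℝ → Per} (hu : Continuous u) :
    Continuous fun s => F.comp (u s) :=
  (ContinuousMap.continuous_postcomp F).comp hu

open BoundedContinuousFunction in
-- Banach's fixed point theorem for `v t = exp (-l t) • u t` in the space of bounded continuous
-- functions. The weight `l = 2L` turns the Lipschitz constant into `L / l = 1 / 2` on the whole
-- half-line.
lemma IsTame.exists_isMild {F F' : C(ℝ, ℝ)} {L : ℝ} (hF : IsTame F F' L) (φ : Per) :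
    ∃ u, IsMild F (2 * L) φ u := by
  have hL := hF.pos
  obtain ⟨l, hl⟩ : ∃ l, l = 2 * L := ⟨_, rfl⟩
  rw [← hl]
  have hl0 : 0 < l := by rw [hl]; positivity
  let N : (ℝ →ᵇ Per) → ℝ → Per := fun v s => F.comp (Real.exp (l * s) • v s)
  have hN : ∀ v, Continuous (N v) := fun v =>
    continuous_comp_left F ((by fun_prop : Continuous fun s : ℝ => Real.exp (l * s)).smul
      v.continuous)
  -- Replacing `t` by `max t 0` extends the map constantly to negative times, so that it acts on
  -- functions on all of `ℝ`.
  let G : (ℝ →ᵇ Per) → ℝ → Per := fun v t =>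
    Real.exp (-(l * max t 0)) • (heat (max t 0) φ + duhamel (N v) (max t 0))
  have hGc : ∀ v, Continuous (G v) := fun v => by
    have h1 : Continuous fun t : ℝ => max t 0 := by fun_prop
    exact (by fun_prop : Continuous fun t : ℝ => Real.exp (-(l * max t 0))).smul
      ((continuous_heat_comp h1 continuous_const).add ((continuous_duhamel (hN v)).comp h1))
  have hdu : ∀ (f : ℝ → Per) (B t : ℝ), 0 ≤ t → 0 ≤ B →
      (∀ s ∈ Icc 0 t, ‖f s‖ ≤ L * B * Real.exp (l * s)) →
      Real.exp (-(l * t)) * ‖duhamel f t‖ ≤ B / 2 := by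
    intro f B t ht hB h
    have h1 := norm_duhamel_le_exp hl0 ht (mul_nonneg hL.le hB) h
    have h2 : L * B / l = B / 2 := by rw [hl]; field_simp
    rw [h2] at h1
    calc Real.exp (-(l * t)) * ‖duhamel f t‖
        ≤ Real.exp (-(l * t)) * (B / 2 * Real.exp (l * t)) := by gcongr
      _ = B / 2 * (Real.exp (-(l * t)) * Real.exp (l * t)) := by ring
      _ = B / 2 := by rw [← Real.exp_add]; simp
  have hGb : ∀ v t, ‖G v t‖ ≤ ‖φ‖ + ‖v‖ / 2 := by
    intro v t
    have ht : 0 ≤ max t 0 := le_max_right _ _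
    have h1 := hdu (N v) ‖v‖ _ ht (norm_nonneg v) fun s _ => by
      refine (hF.norm_comp_le _).trans ?_
      rw [norm_smul, Real.norm_of_nonneg (Real.exp_pos _).le, mul_assoc, mul_comm ‖v‖]
      refine mul_le_mul_of_nonneg_left (mul_le_mul_of_nonneg_left ?_ (Real.exp_pos _).le) hL.le
      exact v.norm_coe_le_norm s
    have h2 : Real.exp (-(l * max t 0)) ≤ 1 := Real.exp_le_one_iff.2 (by nlinarith)
    have h3 : Real.exp (-(l * max t 0)) * ‖heat (max t 0) φ‖ ≤ 1 * ‖φ‖ := by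
      gcongr
      exact norm_heat_le _ _
    simp only [G]
    rw [norm_smul, Real.norm_of_nonneg (Real.exp_pos _).le]
    calc _ ≤ Real.exp (-(l * max t 0)) * (‖heat (max t 0) φ‖ + ‖duhamel (N v) (max t 0)‖) := by
          gcongr; exact norm_add_le _ _
      _ ≤ _ := by linarith
  let T : (ℝ →ᵇ Per) → (ℝ →ᵇ Per) := fun v =>
    BoundedContinuousFunction.ofNormedAddCommGroup (G v) (hGc v) _ (hGb v)
  have hT : ContractingWith (1 / 2) T := by
    refine ⟨by norm_num, LipschitzWith.of_dist_le_mul fun v w => ?_⟩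
    rw [BoundedContinuousFunction.dist_le (by positivity)]
    intro t
    have ht : 0 ≤ max t 0 := le_max_right _ _
    have hcv : Continuous fun s => heat (max t 0 - s) (N v s) :=
      continuous_heat_comp (by fun_prop) (hN v)
    have hcw : Continuous fun s => heat (max t 0 - s) (N w s) :=
      continuous_heat_comp (by fun_prop) (hN w)
    have h0 : duhamel (N v) (max t 0) - duhamel (N w) (max t 0) =
        duhamel (fun s => N v s - N w s) (max t 0) := by
      simp only [duhamel, map_sub]
      exact (intervalIntegral.integral_sub (hcv.intervalIntegrable _ _)
        (hcw.intervalIntegrable _ _)).symm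
    have h1 := hdu (fun s => N v s - N w s) (dist v w) _ ht dist_nonneg fun s _ => by
      refine (hF.norm_comp_sub_le _ _).trans ?_
      rw [← smul_sub, norm_smul, Real.norm_of_nonneg (Real.exp_pos _).le, mul_assoc,
        mul_comm (dist v w)]
      refine mul_le_mul_of_nonneg_left (mul_le_mul_of_nonneg_left ?_ (Real.exp_pos _).le) hL.le
      rw [← dist_eq_norm]
      exact BoundedContinuousFunction.dist_coe_le_dist s
    change dist (G v t) (G w t) ≤ _
    rw [dist_eq_norm]
    simp only [G]
    rw [← smul_sub, add_sub_add_left_eq_sub, h0, norm_smul,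
      Real.norm_of_nonneg (Real.exp_pos _).le]
    refine h1.trans (le_of_eq ?_)
    simp
    ring
  obtain ⟨v, hv⟩ : ∃ v, T v = v := ⟨_, hT.fixedPoint_isFixedPt⟩
  have hv' : ∀ t, G v t = v t := fun t => by
    conv_rhs => rw [← hv]
    rfl
  refine ⟨fun t => Real.exp (l * t) • v t, ?_, fun t ht => ?_, ‖v‖, fun t ht => ?_⟩
  · exact (by fun_prop : Continuous fun s : ℝ => Real.exp (l * s)).smul v.continuous
  · rw [← hv' t]
    simp only [G, max_eq_left ht]
    rw [smul_smul, ← Real.exp_add]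
    simp [N]
  · rw [norm_smul, Real.norm_of_nonneg (Real.exp_pos _).le, mul_comm]
    gcongr
    exact v.norm_coe_le_norm t

/-- The best constant `B` in a bound of the difference by `B exp (2 L t)` is finite by `growth`. The
Duhamel formula gives `B ≤ ‖φ - ψ‖ + B / 2`, whence the factor `2`. -/
lemma IsTame.norm_sub_le_of_isMild {F F' : C(ℝ, ℝ)} {L : ℝ} (hF : IsTame F F' L) {φ ψ : Per}
    {u v : ℝ → Per} (hu : IsMild F (2 * L) φ u) (hv : IsMild F (2 * L) ψ v) {t : ℝ}
    (ht : 0 ≤ t) : ‖u t - v t‖ ≤ 2 * ‖φ - ψ‖ * Real.exp (2 * L * t) := by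
  have hL := hF.pos
  obtain ⟨K, hK⟩ := hu.growth
  obtain ⟨K', hK'⟩ := hv.growth
  have improve : ∀ B, 0 ≤ B → (∀ t, 0 ≤ t → ‖u t - v t‖ ≤ B * Real.exp (2 * L * t)) →
      ∀ t, 0 ≤ t → ‖u t - v t‖ ≤ (‖φ - ψ‖ + B / 2) * Real.exp (2 * L * t) := by
    intro B hB0 hB t ht
    have hcu : Continuous fun s => heat (t - s) (F.comp (u s)) :=
      continuous_heat_comp (by fun_prop) (continuous_comp_left F hu.continuous)
    have hcv : Continuous fun s => heat (t - s) (F.comp (v s)) :=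
      continuous_heat_comp (by fun_prop) (continuous_comp_left F hv.continuous)
    have h0 : u t - v t =
        heat t (φ - ψ) + duhamel (fun s => F.comp (u s) - F.comp (v s)) t := by
      rw [hu.eq t ht, hv.eq t ht, map_sub, duhamel, duhamel, duhamel]
      simp only [map_sub]
      rw [intervalIntegral.integral_sub (hcu.intervalIntegrable _ _)
        (hcv.intervalIntegrable _ _)]
      abel
    have h1 := norm_duhamel_le_exp (f := fun s => F.comp (u s) - F.comp (v s))
      (B := L * B) (l := 2 * L) (by positivity) ht (by positivity) fun s hs => by
        refine (hF.norm_comp_sub_le _ _).trans ?_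
        rw [mul_assoc]
        gcongr
        exact hB s hs.1
    have h2 : L * B / (2 * L) = B / 2 := by field_simp
    rw [h2] at h1
    have h3 : 1 ≤ Real.exp (2 * L * t) := Real.one_le_exp (by positivity)
    rw [h0]
    calc _ ≤ ‖heat t (φ - ψ)‖ + ‖duhamel (fun s => F.comp (u s) - F.comp (v s)) t‖ :=
          norm_add_le _ _
      _ ≤ ‖φ - ψ‖ + B / 2 * Real.exp (2 * L * t) := add_le_add (norm_heat_le _ _) h1
      _ ≤ _ := by nlinarith [norm_nonneg (φ - ψ)]
  set S := {B : ℝ | 0 ≤ B ∧ ∀ t, 0 ≤ t → ‖u t - v t‖ ≤ B * Real.exp (2 * L * t)} with hS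
  have hne : S.Nonempty := by
    refine ⟨|K| + |K'|, by positivity, fun t ht => ?_⟩
    have h1 : K * Real.exp (2 * L * t) ≤ |K| * Real.exp (2 * L * t) := by
      gcongr; exact le_abs_self K
    have h2 : K' * Real.exp (2 * L * t) ≤ |K'| * Real.exp (2 * L * t) := by
      gcongr; exact le_abs_self K'
    linarith [norm_sub_le (u t) (v t), hK t ht, hK' t ht]
  have hbdd : BddBelow S := ⟨0, fun B hB => hB.1⟩
  have hle : sInf S ≤ ‖φ - ψ‖ + sInf S / 2 := by
    by_contra! hlt
    obtain ⟨B, hBS, hB⟩ := exists_lt_of_csInf_lt hne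
      (show sInf S < 2 * (sInf S - ‖φ - ψ‖) by linarith)
    have : sInf S ≤ ‖φ - ψ‖ + B / 2 :=
      csInf_le hbdd ⟨by linarith [hBS.1, norm_nonneg (φ - ψ)], improve B hBS.1 hBS.2⟩
    linarith
  have hge : ‖u t - v t‖ * Real.exp (-(2 * L * t)) ≤ sInf S := by
    refine le_csInf hne fun B hB => ?_
    rw [Real.exp_neg, ← div_eq_mul_inv, div_le_iff₀ (Real.exp_pos _)]
    exact hB.2 t ht
  rw [Real.exp_neg, ← div_eq_mul_inv, div_le_iff₀ (Real.exp_pos _)] at hge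
  refine hge.trans ?_
  gcongr
  linarith

/-! ### Regularity of mild solutions -/

open Classical in
/-- The derivative of a periodic function, with value `0` if there is no continuous derivative. -/
def der (φ : Per) : Per := if h : ∃ ψ, IsDer φ ψ then h.choose else 0

lemma IsDer.der_eq {φ ψ : Per} (h : IsDer φ ψ) : der φ = ψ := by
  have h' : ∃ ψ, IsDer φ ψ := ⟨ψ, h⟩
  rw [der, dif_pos h']
  exact h'.choose_spec.unique h

lemma IsDer.isDer_der {φ ψ : Per} (h : IsDer φ ψ) : IsDer φ (der φ) := by
  rwa [h.der_eq]

/-- A continuous right derivative is a two-sided derivative, since it integrates back to the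
function. -/
lemma hasDerivAt_of_continuousOn_right {E : Type*} [NormedAddCommGroup E] [NormedSpace ℝ E]
    [CompleteSpace E] {w k : ℝ → E} (hw : ContinuousOn w (Ioi 0)) (hk : ContinuousOn k (Ioi 0))
    (h : ∀ t, 0 < t → HasDerivWithinAt w (k t) (Ici t) t) {t : ℝ} (ht : 0 < t) :
    HasDerivAt w (k t) t := by
  have hsub : ∀ s, t / 2 ≤ s → uIcc (t / 2) s ⊆ Ioi (0 : ℝ) := fun s hs r hr => by
    rw [uIcc_of_le hs] at hr
    exact lt_of_lt_of_le (by positivity) hr.1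
  have hint : ∀ s, t / 2 ≤ s → IntervalIntegrable k volume (t / 2) s := fun s hs =>
    (hk.mono (hsub s hs)).intervalIntegrable
  have h1 : ∀ s, t / 2 ≤ s → ∫ r in (t / 2)..s, k r = w s - w (t / 2) := fun s hs => by
    refine intervalIntegral.integral_eq_sub_of_hasDeriv_right_of_le hs ?_ ?_ (hint s hs)
    · have := hsub s hs
      rw [uIcc_of_le hs] at this
      exact hw.mono this
    · intro r hr
      exact (h r (lt_trans (by positivity) hr.1)).mono Ioi_subset_Ici_self
  have h2 : HasDerivAt (fun s => (∫ r in (t / 2)..s, k r) + w (t / 2)) (k t) t := by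
    refine (intervalIntegral.integral_hasDerivAt_right (hint t (by linarith)) ?_
      (hk.continuousAt (Ioi_mem_nhds ht))).add_const _
    exact hk.stronglyMeasurableAtFilter isOpen_Ioi t ht
  refine h2.congr_of_eventuallyEq ?_
  filter_upwards [lt_mem_nhds (show t / 2 < t by linarith)] with s hs
  rw [h1 s hs.le, sub_add_cancel]

namespace IsMild

lemma apply_zero {F : C(ℝ, ℝ)} {l : ℝ} {φ : Per} {u : ℝ → Per} (hu : IsMild F l φ u) :
    u 0 = φ := by
  simpa [duhamel] using hu.eq 0 le_rfl

lemma restart {F : C(ℝ, ℝ)} {l : ℝ} {φ : Per} {u : ℝ → Per} (hu : IsMild F l φ u) {a h : ℝ}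
    (ha : 0 ≤ a) (hh : 0 ≤ h) :
    u (a + h) = heat h (u a) + duhamel (fun s => F.comp (u (a + s))) h := by
  rw [hu.eq _ (add_nonneg ha hh), duhamel_add (continuous_comp_left F hu.continuous) ha hh,
    ← add_assoc, add_comm a h, ← heat_heat hh ha, ← map_add, ← hu.eq a ha]

lemma norm_le {F : C(ℝ, ℝ)} {l : ℝ} {φ : Per} {u : ℝ → Per} (hu : IsMild F l φ u) {s t : ℝ}
    (hs : 0 ≤ s) (hst : s ≤ t) : ‖u t‖ ≤ ‖u s‖ + ∫ r in s..t, ‖F.comp (u r)‖ := by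
  obtain ⟨h, rfl⟩ : ∃ h, t = s + h := ⟨t - s, by ring⟩
  have hh : 0 ≤ h := by linarith
  have hc := continuous_comp_left F hu.continuous
  rw [hu.restart hs hh]
  refine (norm_add_le _ _).trans (add_le_add (norm_heat_le _ _) ?_)
  refine (norm_duhamel_le _ (hc.comp (by fun_prop)).continuousOn hh).trans (le_of_eq ?_)
  have h1 := intervalIntegral.integral_comp_add_left (a := 0) (b := h)
      (fun r => ‖F.comp (u r)‖) s
  rwa [add_zero] at h1

lemma isDer {F : C(ℝ, ℝ)} {l : ℝ} {φ : Per} {u : ℝ → Per} (hu : IsMild F l φ u) {t : ℝ}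
    (ht : 0 < t) :
    IsDer (u t) (heatGrad t φ + duhamelGrad (fun s => F.comp (u s)) t) := by
  have h := (isDer_heat ht φ).add (isDer_duhamel (continuous_comp_left F hu.continuous) ht.le)
  rwa [← hu.eq t ht.le] at h

lemma continuousOn_der {F : C(ℝ, ℝ)} {l : ℝ} {φ : Per} {u : ℝ → Per} (hu : IsMild F l φ u) :
    ContinuousOn (fun t => der (u t)) (Ioi 0) := by
  have h : ContinuousOn (fun t => heatGrad t φ + duhamelGrad (fun s => F.comp (u s)) t) (Ioi 0) :=
    (continuousOn_heatGrad φ).add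
      (continuous_duhamelGrad (continuous_comp_left F hu.continuous)).continuousOn
  exact h.congr fun t ht => (hu.isDer ht).der_eq

/-- Bootstrap: after restarting at `a > 0` the datum `u a` is already differentiable, and so is the
source, with a derivative continuous down to the new initial time. The first-order formula can
therefore be differentiated once more. -/
lemma exists_isDer_der {F F' : C(ℝ, ℝ)} (hF : ∀ r, HasDerivAt F (F' r) r) {l : ℝ} {φ : Per}
    {u : ℝ → Per} (hu : IsMild F l φ u) {a : ℝ} (ha : 0 < a) :
    ∃ z : ℝ → Per, ContinuousOn z (Ioi a) ∧ ∀ t, a < t → IsDer (der (u t)) (z t) := by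
  set f : ℝ → Per := fun s => F.comp (u (a + max s 0)) with hf
  set g : ℝ → Per := fun s => F'.comp (u (a + max s 0)) * der (u (a + max s 0)) with hg
  have hpos : ∀ s : ℝ, 0 < a + max s 0 := fun s => by
    have := le_max_right s 0
    linarith
  have hfc : Continuous f := (continuous_comp_left F hu.continuous).comp (by fun_prop)
  have hdc : Continuous fun s : ℝ => der (u (a + max s 0)) :=
    hu.continuousOn_der.comp_continuous (by fun_prop) hpos
  have hgc : Continuous g :=
    ((continuous_comp_left F' hu.continuous).comp (by fun_prop)).mul hdc
  have hfg : ∀ s, IsDer (f s) (g s) := fun s x => by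
    have h1 := (hu.isDer (hpos s)).isDer_der x
    exact (hF _).comp x h1
  have hres : ∀ h, 0 ≤ h → u (a + h) = heat h (u a) + duhamel f h := fun h hh => by
    rw [hu.restart ha.le hh]
    congr 1
    refine duhamel_congr hh fun s hs => ?_
    simp only [hf]
    rw [max_eq_left hs.1]
  have hder : ∀ h, 0 ≤ h → der (u (a + h)) = heat h (der (u a)) + duhamelGrad f h :=
    fun h hh => by
      have h1 := (((hu.isDer ha).isDer_der).avg √(2 * h)).add (isDer_duhamel hfc hh)
      have h2 : IsDer (u (a + h)) (heat h (der (u a)) + duhamelGrad f h) := by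
        rw [hres h hh]; exact h1
      exact h2.der_eq
  refine ⟨fun t => heatGrad (t - a) (der (u a)) + duhamelGrad g (t - a), ?_, fun t ht => ?_⟩
  · refine ContinuousOn.add ?_ ((continuous_duhamelGrad hgc).comp (by fun_prop)).continuousOn
    exact (continuousOn_heatGrad _).comp (by fun_prop)
      fun t ht => mem_Ioi.2 (sub_pos.2 ht)
  · have h1 := (isDer_heat (sub_pos.2 ht) (der (u a))).add
      (isDer_duhamelGrad hfc hgc hfg (t - a))
    rwa [← hder _ (sub_nonneg.2 ht.le), add_sub_cancel] at h1

lemma isDer_der {F F' : C(ℝ, ℝ)} (hF : ∀ r, HasDerivAt F (F' r) r) {l : ℝ} {φ : Per}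
    {u : ℝ → Per} (hu : IsMild F l φ u) {t : ℝ} (ht : 0 < t) :
    IsDer (der (u t)) (der (der (u t))) := by
  obtain ⟨z, _, hz⟩ := hu.exists_isDer_der hF (half_pos ht)
  exact (hz t (half_lt_self ht)).isDer_der

lemma continuousOn_der_der {F F' : C(ℝ, ℝ)} (hF : ∀ r, HasDerivAt F (F' r) r) {l : ℝ} {φ : Per}
    {u : ℝ → Per} (hu : IsMild F l φ u) :
    ContinuousOn (fun t => der (der (u t))) (Ioi 0) := by
  intro t ht
  have ht : 0 < t := ht
  obtain ⟨z, hzc, hz⟩ := hu.exists_isDer_der hF (half_pos ht)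
  have h1 : Ioi (t / 2) ∈ 𝓝 t := Ioi_mem_nhds (half_lt_self ht)
  refine ((hzc.continuousAt h1).congr ?_).continuousWithinAt
  filter_upwards [h1] with s hs
  exact (hz s hs).der_eq.symm

/-- Restarting at `a` expresses the increment through `heat_sub_eq_integral` and a Duhamel term,
both with known right derivatives at the origin. -/
lemma hasDerivAt {F F' : C(ℝ, ℝ)} (hF : ∀ r, HasDerivAt F (F' r) r) {l : ℝ} {φ : Per}
    {u : ℝ → Per} (hu : IsMild F l φ u) {t : ℝ} (ht : 0 < t) :
    HasDerivAt u (der (der (u t)) + F.comp (u t)) t := by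
  have hfc := continuous_comp_left F hu.continuous
  refine hasDerivAt_of_continuousOn_right (k := fun t => der (der (u t)) + F.comp (u t))
    hu.continuous.continuousOn
    ((hu.continuousOn_der_der hF).add hfc.continuousOn) (fun a ha => ?_) ht
  have hχ := continuous_heat_apply (der (der (u a)))
  have h1 : HasDerivWithinAt (fun h => u a + (∫ s in (0 : ℝ)..h, heat s (der (der (u a)))) +
      duhamel (fun s => F.comp (u (a + s))) h) (der (der (u a)) + F.comp (u a)) (Ici 0) 0 := by
    have h2 := (intervalIntegral.integral_hasDerivAt_right (hχ.intervalIntegrable 0 0)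
      hχ.stronglyMeasurable.stronglyMeasurableAtFilter hχ.continuousAt).const_add (u a)
    have h3 := hasDerivWithinAt_duhamel_zero (f := fun s => F.comp (u (a + s)))
      (hfc.comp (by fun_prop))
    exact (h2.hasDerivWithinAt.add h3).congr_deriv (by rw [heat_zero, add_zero])
  have h4 : HasDerivWithinAt (fun t => t - a) 1 (Ici a) a :=
    ((hasDerivAt_id a).sub_const a).hasDerivWithinAt
  have h5 := HasDerivWithinAt.scomp_of_eq (t' := Ici 0) (y := 0) a h1 h4
    (fun s hs => mem_Ici.2 (sub_nonneg.2 hs)) (by simp)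
  rw [one_smul] at h5
  refine h5.congr_of_mem (fun s hs => ?_) self_mem_Ici
  have hs : 0 ≤ s - a := sub_nonneg.2 hs
  have h6 := heat_sub_eq_integral (hu.isDer ha).isDer_der (hu.isDer_der hF ha) hs
  have h7 := hu.restart ha.le hs
  rw [add_sub_cancel] at h7
  simp only [Function.comp]
  rw [h7, ← h6, add_sub_cancel]

end IsMild

/-- If the datum is odd, so is the mild solution. -/
lemma IsTame.reflect_eq {F F' : C(ℝ, ℝ)} {L : ℝ} (hF : IsTame F F' L) {φ : Per} {u : ℝ → Per}
    (hu : IsMild F (2 * L) φ u) (hφ : reflect φ = φ) {t : ℝ} (ht : 0 ≤ t) :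
    reflect (u t) = u t := by
  have hrF : ∀ ψ : Per, reflect (F.comp ψ) = F.comp (reflect ψ) := fun ψ => by
    ext x; simp [hF.odd]
  -- The reflected function is a mild solution with the same datum, so uniqueness applies.
  have hv : IsMild F (2 * L) φ fun t => reflect (u t) := by
    refine ⟨continuous_reflect.comp hu.continuous, fun t ht => ?_, ?_⟩
    · have hc : Continuous fun s => heat (t - s) (F.comp (u s)) :=
        continuous_heat_comp (by fun_prop) (continuous_comp_left F hu.continuous)
      have h1 : reflect (duhamel (fun s => F.comp (u s)) t) =
          duhamel (fun s => F.comp (reflect (u s))) t := by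
        change reflectCLM _ = _
        rw [duhamel, ← ContinuousLinearMap.intervalIntegral_comp_comm _
          (hc.intervalIntegrable _ _)]
        refine intervalIntegral.integral_congr fun s _ => ?_
        change reflect (heat (t - s) (F.comp (u s))) = _
        rw [reflect_heat, hrF]
      conv_lhs => rw [hu.eq t ht]
      rw [← h1]
      conv_rhs => rw [← hφ, ← reflect_heat]
      exact map_add reflectCLM _ _
    · obtain ⟨K, hK⟩ := hu.growth
      exact ⟨K, fun t ht => (norm_reflect_le _).trans (hK t ht)⟩
  have := hF.norm_sub_le_of_isMild hv hu ht
  rw [sub_self, norm_zero, mul_zero, zero_mul] at this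
  exact sub_eq_zero.1 (norm_le_zero_iff.1 this)

/-- At a positive time the solution depends on the datum in a Lipschitz way even in `C¹`, while the
data are compared only in the supremum norm. This makes the energy continuous in the datum. -/
lemma IsTame.exists_norm_der_sub_le {F F' : C(ℝ, ℝ)} {L : ℝ} (hF : IsTame F F' L) {t : ℝ}
    (ht : 0 < t) : ∃ C, ∀ φ ψ u v, IsMild F (2 * L) φ u → IsMild F (2 * L) ψ v →
      ‖der (u t) - der (v t)‖ ≤ C * ‖φ - ψ‖ := by
  refine ⟨‖heatGrad t‖ + (∫ z, ‖z‖ ∂stdGaussian) * (L * (2 * Real.exp (2 * L * t))) * √(2 * t),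
    fun φ ψ u v hu hv => ?_⟩
  have hL := hF.pos
  have h1 : der (u t) - der (v t) = heatGrad t (φ - ψ) +
      duhamelGrad (fun s => F.comp (u s) - F.comp (v s)) t := by
    have hcu : Continuous fun σ => moment σ (F.comp (u (t - σ ^ 2 / 2))) :=
      continuous_moment_comp continuous_id
        ((continuous_comp_left F hu.continuous).comp (by fun_prop))
    have hcv : Continuous fun σ => moment σ (F.comp (v (t - σ ^ 2 / 2))) :=
      continuous_moment_comp continuous_id
        ((continuous_comp_left F hv.continuous).comp (by fun_prop))
    rw [(hu.isDer ht).der_eq, (hv.isDer ht).der_eq, map_sub]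
    simp only [duhamelGrad, map_sub]
    rw [intervalIntegral.integral_sub (hcu.intervalIntegrable _ _) (hcv.intervalIntegrable _ _)]
    abel
  rw [h1, add_mul]
  refine (norm_add_le _ _).trans (add_le_add ((heatGrad t).le_opNorm _) ?_)
  refine (norm_duhamelGrad_le (B := L * (2 * ‖φ - ψ‖ * Real.exp (2 * L * t))) ht.le
    fun s hs => ?_).trans (le_of_eq (by ring))
  refine (hF.norm_comp_sub_le _ _).trans (mul_le_mul_of_nonneg_left ?_ hL.le)
  refine (hF.norm_sub_le_of_isMild hu hv hs.1).trans ?_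
  gcongr
  exact hs.2

/-- Regular solutions on `[0,T)` of `∂ₜ u = ∂ₓₓ u + F(u)`, odd and periodic in space. -/
structure IsRegular (F : C(ℝ, ℝ)) (T : ℝ) (u : ℝ → Per) : Prop where
  continuousOn : ContinuousOn u (Ico 0 T)
  isDer : ∀ t ∈ Ioo 0 T, IsDer (u t) (der (u t))
  isDer_der : ∀ t ∈ Ioo 0 T, IsDer (der (u t)) (der (der (u t)))
  continuousOn_der : ContinuousOn (fun t => der (u t)) (Ioo 0 T)
  continuousOn_der_der : ContinuousOn (fun t => der (der (u t))) (Ioo 0 T)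
  hasDerivAt : ∀ t ∈ Ioo 0 T, HasDerivAt u (der (der (u t)) + F.comp (u t)) t
  reflect_eq : ∀ t ∈ Ico 0 T, reflect (u t) = u t
  -- What is kept of the mild formulation, as input for Gronwall's inequality.
  norm_le : ∀ s t, 0 ≤ s → s ≤ t → t < T → ‖u t‖ ≤ ‖u s‖ + ∫ r in s..t, ‖F.comp (u r)‖

lemma IsTame.isRegular {F F' : C(ℝ, ℝ)} {L : ℝ} (hF : IsTame F F' L) {φ : Per} {u : ℝ → Per}
    (hu : IsMild F (2 * L) φ u) (hφ : reflect φ = φ) (T : ℝ) : IsRegular F T u where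
  continuousOn := hu.continuous.continuousOn
  isDer _ ht := (hu.isDer ht.1).isDer_der
  isDer_der _ ht := hu.isDer_der hF.hasDerivAt ht.1
  continuousOn_der := hu.continuousOn_der.mono fun _ ht => ht.1
  continuousOn_der_der := (hu.continuousOn_der_der hF.hasDerivAt).mono fun _ ht => ht.1
  hasDerivAt _ ht := hu.hasDerivAt hF.hasDerivAt ht.1
  reflect_eq _ ht := hF.reflect_eq hu hφ ht.1
  norm_le _ _ hs hst _ := hu.norm_le hs hst

/-! ### The source term and its truncations -/

lemma source_neg (p r : ℝ) : source p (-r) = -source p r := by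
  simp [source]

lemma hasDerivAt_source {p : ℝ} (hp : 1 < p) (r : ℝ) :
    HasDerivAt (source p) (p * |r| ^ (p - 1)) r := by
  have hpos : ∀ r : ℝ, 0 < r → HasDerivAt (source p) (p * |r| ^ (p - 1)) r := by
    intro r hr
    have h1 := Real.hasDerivAt_rpow_const (x := r) (p := p) (Or.inl hr.ne')
    rw [abs_of_pos hr]
    refine h1.congr_of_eventuallyEq ?_
    filter_upwards [lt_mem_nhds hr] with s hs
    rw [source, abs_of_pos hs, Real.rpow_sub_one hs.ne']
    field_simp
  rcases lt_trichotomy r 0 with hr | rfl | hr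
  · have h1 := (hpos (-r) (neg_pos.2 hr)).scomp r (hasDerivAt_neg r)
    have h2 := h1.neg
    simp only [abs_neg, smul_eq_mul, neg_mul, one_mul, neg_neg] at h2
    refine h2.congr_of_eventuallyEq (Eventually.of_forall fun s => ?_)
    simp [source_neg]
  · rw [abs_zero, Real.zero_rpow (by linarith), mul_zero, hasDerivAt_iff_tendsto_slope]
    have h1 : Tendsto (fun s : ℝ => |s| ^ (p - 1)) (𝓝[≠] 0) (𝓝 0) := by
      have h2 : Continuous fun s : ℝ => |s| ^ (p - 1) :=
        continuous_abs.rpow_const fun s => Or.inr (by linarith)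
      have h3 := h2.tendsto 0
      rw [abs_zero, Real.zero_rpow (by linarith)] at h3
      exact h3.mono_left nhdsWithin_le_nhds
    refine h1.congr' ?_
    filter_upwards [self_mem_nhdsWithin] with s hs
    have hs : s ≠ 0 := hs
    simp [slope_def_field, source, hs]
  · exact hpos r hr

lemma continuous_source {p : ℝ} (hp : 1 < p) : Continuous (source p) :=
  continuous_iff_continuousAt.2 fun r => (hasDerivAt_source hp r).continuousAt

/-- The source term as a bundled continuous map. -/
def sourceMap {p : ℝ} (hp : 1 < p) : C(ℝ, ℝ) := ⟨source p, continuous_source hp⟩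

@[simp] lemma sourceMap_apply {p : ℝ} (hp : 1 < p) (r : ℝ) : sourceMap hp r = source p r := rfl

/-- The derivative of the source term truncated at level `M`. -/
def truncDeriv {p : ℝ} (hp : 1 < p) (M : ℝ) : C(ℝ, ℝ) :=
  ⟨fun r => p * (min |r| M) ^ (p - 1), continuous_const.mul
    ((continuous_abs.min continuous_const).rpow_const fun _ => Or.inr (by linarith))⟩

lemma truncDeriv_apply {p : ℝ} (hp : 1 < p) (M r : ℝ) :
    truncDeriv hp M r = p * (min |r| M) ^ (p - 1) := rfl

lemma hasDerivAt_integral_truncDeriv {p : ℝ} (hp : 1 < p) (M r : ℝ) :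
    HasDerivAt (fun r => ∫ s in (0 : ℝ)..r, truncDeriv hp M s) (truncDeriv hp M r) r :=
  intervalIntegral.integral_hasDerivAt_right
    ((truncDeriv hp M).continuous.intervalIntegrable _ _)
    (truncDeriv hp M).continuous.stronglyMeasurable.stronglyMeasurableAtFilter
    (truncDeriv hp M).continuous.continuousAt

/-- The source term, extended linearly outside `[-M, M]`. -/
def trunc {p : ℝ} (hp : 1 < p) (M : ℝ) : C(ℝ, ℝ) :=
  ⟨fun r => ∫ s in (0 : ℝ)..r, truncDeriv hp M s, continuous_iff_continuousAt.2 fun r =>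
    (hasDerivAt_integral_truncDeriv hp M r).continuousAt⟩

lemma trunc_apply {p : ℝ} (hp : 1 < p) (M r : ℝ) :
    trunc hp M r = ∫ s in (0 : ℝ)..r, truncDeriv hp M s := rfl

lemma isTame_trunc {p : ℝ} (hp : 1 < p) {M : ℝ} (hM : 0 < M) :
    IsTame (trunc hp M) (truncDeriv hp M) (p * M ^ (p - 1)) where
  pos := by have : 0 < p := by linarith
            positivity
  hasDerivAt r := hasDerivAt_integral_truncDeriv hp M r
  bound r := by
    have h0 : 0 ≤ min |r| M := le_min (abs_nonneg r) hM.le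
    have h1 : (min |r| M) ^ (p - 1) ≤ M ^ (p - 1) :=
      Real.rpow_le_rpow h0 (min_le_right _ _) (by linarith)
    have h2 : 0 ≤ (min |r| M) ^ (p - 1) := Real.rpow_nonneg h0 _
    rw [truncDeriv_apply, abs_of_nonneg (mul_nonneg (by linarith) h2)]
    exact mul_le_mul_of_nonneg_left h1 (by linarith)
  odd r := by
    have h1 := intervalIntegral.integral_comp_neg (a := 0) (b := r) fun s => truncDeriv hp M s
    simp only [truncDeriv_apply, abs_neg, neg_zero] at h1
    rw [trunc_apply, trunc_apply, intervalIntegral.integral_symm]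
    simp only [truncDeriv_apply]
    rw [h1]

lemma trunc_eq_source {p : ℝ} (hp : 1 < p) {M r : ℝ} (hr : |r| ≤ M) :
    trunc hp M r = source p r := by
  have h1 : ∫ s in (0 : ℝ)..r, p * |s| ^ (p - 1) = source p r - source p 0 := by
    refine intervalIntegral.integral_eq_sub_of_hasDerivAt (fun s _ => hasDerivAt_source hp s) ?_
    exact (continuous_const.mul (continuous_abs.rpow_const fun _ =>
      Or.inr (by linarith))).intervalIntegrable _ _
  have h2 : source p 0 = 0 := by simp [source]
  rw [h2, sub_zero] at h1
  rw [trunc_apply, ← h1]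
  refine intervalIntegral.integral_congr fun s hs => ?_
  have h3 : |s| ≤ |r| := by
    rcases le_total 0 r with h | h
    · rw [uIcc_of_le h] at hs
      rw [abs_of_nonneg hs.1, abs_of_nonneg h]; exact hs.2
    · rw [uIcc_of_ge h] at hs
      rw [abs_of_nonpos hs.2, abs_of_nonpos h]; linarith [hs.1]
  simp only [truncDeriv_apply]
  rw [min_eq_left (h3.trans hr)]

lemma trunc_comp_eq {p : ℝ} (hp : 1 < p) {M : ℝ} {φ : Per} (hφ : ‖φ‖ ≤ M) :
    (trunc hp M).comp φ = (sourceMap hp).comp φ := by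
  ext x
  exact trunc_eq_source hp ((φ.norm_coe_le_norm x).trans hφ)

lemma abs_source (p r : ℝ) : |source p r| = |r| ^ (p - 1) * |r| := by
  rw [source, abs_mul, abs_of_nonneg (Real.rpow_nonneg (abs_nonneg r) _), mul_comm]

lemma abs_source_sub_le {p : ℝ} (hp : 1 < p) {M r s : ℝ} (hM : 0 < M) (hr : |r| ≤ M)
    (hs : |s| ≤ M) : |source p r - source p s| ≤ p * M ^ (p - 1) * |r - s| := by
  rw [← trunc_eq_source hp hr, ← trunc_eq_source hp hs]
  exact (isTame_trunc hp hM).abs_sub_le r s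

/-- The potential `|r|^(p+1)/(p+1)` of the source term. -/
def potential (p r : ℝ) : ℝ := |r| ^ (p + 1) / (p + 1)

lemma hasDerivAt_potential {p : ℝ} (hp : 1 < p) (r : ℝ) :
    HasDerivAt (potential p) (source p r) r := by
  have h := (hasDerivAt_abs_rpow r (p := p + 1) (by linarith)).div_const (p + 1)
  refine h.congr_deriv ?_
  have : p + 1 ≠ 0 := by linarith
  rw [source, show p + 1 - 2 = p - 1 by ring]
  field_simp

/-- The potential as a bundled continuous map. -/
def potentialMap {p : ℝ} (hp : 1 < p) : C(ℝ, ℝ) :=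
  ⟨potential p, continuous_iff_continuousAt.2 fun r => (hasDerivAt_potential hp r).continuousAt⟩

@[simp] lemma potentialMap_apply {p : ℝ} (hp : 1 < p) (r : ℝ) :
    potentialMap hp r = potential p r := rfl

/-! ### Odd periodic extension -/

/-- The odd extension to `[-1,1]` of a function on `[0,1]`. -/
def oddFun (u : DirichletData) (x : ℝ) : ℝ :=
  u.1 (projIcc 0 1 zero_le_one x) - u.1 (projIcc 0 1 zero_le_one (-x))

lemma continuous_oddFun (u : DirichletData) : Continuous (oddFun u) :=
  (u.1.continuous.comp continuous_projIcc).sub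
    (u.1.continuous.comp (continuous_projIcc.comp continuous_neg))

lemma oddFun_of_nonneg (u : DirichletData) {x : ℝ} (hx : 0 ≤ x) :
    oddFun u x = u.1 (projIcc 0 1 zero_le_one x) := by
  rw [oddFun, projIcc_of_le_left zero_le_one (neg_nonpos.2 hx)]
  have : u.1 (⟨0, left_mem_Icc.2 zero_le_one⟩ : unitInterval) = 0 := u.2.1
  rw [this, sub_zero]

lemma oddFun_neg (u : DirichletData) (x : ℝ) : oddFun u (-x) = -oddFun u x := by
  simp [oddFun]

lemma oddFun_one (u : DirichletData) : oddFun u 1 = 0 := by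
  rw [oddFun_of_nonneg u zero_le_one, projIcc_right]
  exact u.2.2

/-- The odd `2`-periodic extension of a datum. -/
def oddExt (u : DirichletData) : Per :=
  ⟨AddCircle.liftIco 2 (-1) (oddFun u), AddCircle.liftIco_continuous
    (by norm_num [oddFun_neg, oddFun_one]) (continuous_oddFun u).continuousOn⟩

lemma oddExt_coe (u : DirichletData) {x : ℝ} (hx : x ∈ Icc (-1 : ℝ) 1) :
    oddExt u (x : AddCircle (2 : ℝ)) = oddFun u x := by
  rcases eq_or_lt_of_le hx.2 with rfl | h
  · have h1 : ((1 : ℝ) : AddCircle (2 : ℝ)) = ((-1 : ℝ) : AddCircle (2 : ℝ)) := by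
      rw [← AddCircle.coe_add_period 2 (-1)]; norm_num
    rw [h1]
    refine (AddCircle.liftIco_coe_apply (𝕜 := ℝ) (p := 2) (a := -1) (f := oddFun u) (by norm_num)).trans ?_
    rw [oddFun_neg, oddFun_one, neg_zero]
  · exact AddCircle.liftIco_coe_apply (𝕜 := ℝ) (p := 2) (a := -1) (f := oddFun u) ⟨hx.1, by linarith⟩

lemma exists_coe_Icc (x : AddCircle (2 : ℝ)) : ∃ y ∈ Icc (-1 : ℝ) 1, (y : AddCircle (2 : ℝ)) = x := by
  obtain ⟨y, hy, rfl⟩ := (AddCircle.coe_image_Ico_eq 2 (-1 : ℝ)).symm ▸ mem_univ x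
  exact ⟨y, ⟨hy.1, by linarith [hy.2]⟩, rfl⟩

lemma reflect_oddExt (u : DirichletData) : reflect (oddExt u) = oddExt u := by
  ext x
  obtain ⟨y, hy, rfl⟩ := exists_coe_Icc x
  rw [reflect_apply, ← AddCircle.coe_neg, oddExt_coe u hy,
    oddExt_coe u ⟨by linarith [hy.2], by linarith [hy.1]⟩, oddFun_neg, neg_neg]

lemma oddExt_apply (u : DirichletData) (x : unitInterval) :
    oddExt u ((x : ℝ) : AddCircle (2 : ℝ)) = u.1 x := by
  rw [oddExt_coe u ⟨by linarith [x.2.1], x.2.2⟩, oddFun_of_nonneg u x.2.1, projIcc_val]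

lemma apply_neg_of_reflect {φ : Per} (hφ : reflect φ = φ) (x : AddCircle (2 : ℝ)) :
    φ (-x) = -φ x := by
  have := DFunLike.congr_fun hφ x
  rw [reflect_apply] at this
  linarith

lemma apply_zero_of_reflect {φ : Per} (hφ : reflect φ = φ) : φ ((0 : ℝ) : AddCircle (2 : ℝ)) = 0 := by
  have := apply_neg_of_reflect hφ ((0 : ℝ) : AddCircle (2 : ℝ))
  rw [← AddCircle.coe_neg, neg_zero] at this
  linarith

lemma apply_one_of_reflect {φ : Per} (hφ : reflect φ = φ) : φ ((1 : ℝ) : AddCircle (2 : ℝ)) = 0 := by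
  have := apply_neg_of_reflect hφ ((1 : ℝ) : AddCircle (2 : ℝ))
  have h1 : ((1 : ℝ) : AddCircle (2 : ℝ)) = ((-1 : ℝ) : AddCircle (2 : ℝ)) := by
    rw [← AddCircle.coe_add_period 2 (-1)]; norm_num
  rw [← AddCircle.coe_neg, ← h1] at this
  linarith

/-- The norm of an odd periodic function is attained on `[0,1]`. -/
lemma norm_le_of_reflect {φ : Per} (hφ : reflect φ = φ) {B : ℝ} (hB : 0 ≤ B)
    (h : ∀ x ∈ Icc (0 : ℝ) 1, |φ (x : AddCircle (2 : ℝ))| ≤ B) : ‖φ‖ ≤ B := by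
  refine (ContinuousMap.norm_le _ hB).2 fun x => ?_
  obtain ⟨y, hy, rfl⟩ := exists_coe_Icc x
  rcases le_total 0 y with h0 | h0
  · exact h y ⟨h0, hy.2⟩
  · have := h (-y) ⟨by linarith, by linarith [hy.1]⟩
    rwa [AddCircle.coe_neg, apply_neg_of_reflect hφ, abs_neg] at this

lemma norm_oddExt_sub_le (u v : DirichletData) : ‖oddExt u - oddExt v‖ ≤ dist u v := by
  have h0 : reflect (oddExt u - oddExt v) = oddExt u - oddExt v := by
    change reflectCLM _ = _
    rw [map_sub]
    change reflect _ - reflect _ = _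
    rw [reflect_oddExt, reflect_oddExt]
  refine norm_le_of_reflect h0 dist_nonneg fun x hx => ?_
  have h1 := oddExt_apply u ⟨x, hx⟩
  have h2 := oddExt_apply v ⟨x, hx⟩
  simp only at h1 h2
  rw [ContinuousMap.sub_apply, h1, h2, ← Real.dist_eq]
  exact ContinuousMap.dist_apply_le_dist (f := u.1) (g := v.1) _

/-! ### Maximum principle and comparison -/

/-- If `b > 0`, the second derivative test makes `x` a local minimum as well. Then `f` is locally
constant and `b = 0`. -/
lemma second_deriv_nonpos_of_isLocalMax {f : ℝ → ℝ} {x b : ℝ} (hmax : IsLocalMax f x)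
    (hf : ContinuousAt f x) (hb : HasDerivAt (deriv f) b x) : b ≤ 0 := by
  by_contra! hpos
  have hmin : IsLocalMin f x :=
    isLocalMin_of_deriv_deriv_pos (by rwa [hb.deriv]) hmax.deriv_eq_zero hf
  have hconst : f =ᶠ[𝓝 x] fun _ => f x := by
    filter_upwards [hmax, hmin] with y h1 h2
    exact le_antisymm h1 h2
  have h1 : deriv f =ᶠ[𝓝 x] fun _ => 0 := by
    filter_upwards [hconst.eventuallyEq_nhds] with y hy
    rw [hy.deriv_eq, deriv_const]
  have h2 := hb.congr_of_eventuallyEq h1.symm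
  have := h2.unique (hasDerivAt_const x (0 : ℝ))
  linarith

/-- Only earlier times are compared, since the space-time maximum may sit at the final time. -/
lemma hasDerivAt_nonneg_of_forall_le {f : ℝ → ℝ} {d t : ℝ} (ht : 0 < t) (hd : HasDerivAt f d t)
    (h : ∀ r ∈ Icc 0 t, f r ≤ f t) : 0 ≤ d := by
  have h1 : Tendsto (slope f t) (𝓝[<] t) (𝓝 d) :=
    (hasDerivAt_iff_tendsto_slope.1 hd).mono_left (nhdsWithin_mono _ fun r hr => ne_of_lt hr)
  refine ge_of_tendsto h1 ?_
  filter_upwards [Ioo_mem_nhdsLT ht] with r hr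
  rw [slope_def_field]
  exact div_nonneg_of_nonpos (by linarith [h r ⟨hr.1.le, hr.2.le⟩]) (by linarith [hr.2])

/-- At a positive maximum of `exp (-(L + 1) t) w` one has `a ≥ (L + 1) w` and `b ≤ 0`, contradicting
`a - b ≤ L w`. -/
lemma nonpos_of_differential_inequality {s L : ℝ} {w : ℝ → ℝ → ℝ}
    (hc : ContinuousOn (fun q : ℝ × ℝ => w q.1 q.2) (Icc 0 s ×ˢ Icc 0 1))
    (h0 : ∀ x ∈ Icc (0 : ℝ) 1, w 0 x ≤ 0) (hl : ∀ t ∈ Icc 0 s, w t 0 ≤ 0)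
    (hr : ∀ t ∈ Icc 0 s, w t 1 ≤ 0)
    (hd : ∀ t ∈ Ioc 0 s, ∀ x ∈ Ioo (0 : ℝ) 1, ∃ a b, HasDerivAt (fun r => w r x) a t ∧
      HasDerivAt (deriv (w t)) b x ∧ a - b ≤ L * |w t x|) :
    ∀ t ∈ Icc 0 s, ∀ x ∈ Icc (0 : ℝ) 1, w t x ≤ 0 := by
  intro t₀ ht₀ x₀ hx₀
  by_contra! hpos
  set v : ℝ × ℝ → ℝ := fun q => Real.exp (-((L + 1) * q.1)) * w q.1 q.2 with hv
  have hvc : ContinuousOn v (Icc 0 s ×ˢ Icc 0 1) :=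
    (by fun_prop : Continuous fun q : ℝ × ℝ => Real.exp (-((L + 1) * q.1))).continuousOn.mul hc
  obtain ⟨⟨t, x⟩, ⟨ht, hx⟩, hmax⟩ := (isCompact_Icc.prod isCompact_Icc).exists_isMaxOn
    ⟨(t₀, x₀), ht₀, hx₀⟩ hvc
  have hmax' : ∀ r ∈ Icc 0 s, ∀ y ∈ Icc (0 : ℝ) 1, v (r, y) ≤ v (t, x) :=
    fun r hr y hy => hmax (show (r, y) ∈ Icc 0 s ×ˢ Icc 0 1 from ⟨hr, hy⟩)
  have hvpos : 0 < v (t, x) :=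
    lt_of_lt_of_le (mul_pos (Real.exp_pos _) hpos) (hmax' t₀ ht₀ x₀ hx₀)
  have hwpos : 0 < w t x := (pos_iff_pos_of_mul_pos hvpos).1 (Real.exp_pos _)
  simp only at ht hx
  have ht0 : 0 < t := by
    refine lt_of_le_of_ne ht.1 fun h => ?_
    subst h
    linarith [h0 x hx]
  have hx0 : 0 < x := by
    refine lt_of_le_of_ne hx.1 fun h => ?_
    subst h
    linarith [hl t ht]
  have hx1 : x < 1 := by
    refine lt_of_le_of_ne hx.2 fun h => ?_
    subst h
    linarith [hr t ht]
  obtain ⟨a, b, ha, hb, hab⟩ := hd t ⟨ht0, ht.2⟩ x ⟨hx0, hx1⟩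
  have hlocmax : IsLocalMax (w t) x := by
    filter_upwards [Ioo_mem_nhds hx0 hx1] with y hy
    exact le_of_mul_le_mul_left (hmax' t ht y ⟨hy.1.le, hy.2.le⟩) (Real.exp_pos _)
  have hct : ContinuousAt (w t) x := by
    have h1 : ContinuousOn (w t) (Icc 0 1) :=
      hc.comp (f := fun y => (t, y)) (by fun_prop) fun y hy => ⟨ht, hy⟩
    exact h1.continuousAt (Icc_mem_nhds hx0 hx1)
  have hb0 := second_deriv_nonpos_of_isLocalMax hlocmax hct hb
  have hexp : HasDerivAt (fun r : ℝ => Real.exp (-((L + 1) * r)))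
      (Real.exp (-((L + 1) * t)) * (-(L + 1))) t := by
    refine (((hasDerivAt_id t).const_mul (L + 1)).neg).exp.congr_deriv ?_
    simp
  have hderiv := hasDerivAt_nonneg_of_forall_le ht0 (hexp.mul ha)
    fun r hr => hmax' r ⟨hr.1, hr.2.trans ht.2⟩ x hx
  have h1 : 0 ≤ Real.exp (-((L + 1) * t)) * (a - (L + 1) * w t x) := by
    convert hderiv using 1; ring
  have h2 := nonneg_of_mul_nonneg_right h1 (Real.exp_pos _)
  rw [abs_of_pos hwpos] at hab
  linarith

/-- `U` is a classical solution of `∂ₜ U = ∂ₓₓ U + F(U)` on `[0,s] × [0,1]` with homogeneous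
Dirichlet boundary conditions. -/
structure IsClassicalOn (F : ℝ → ℝ) (s : ℝ) (U : ℝ → ℝ → ℝ) : Prop where
  continuousOn : ContinuousOn (fun q : ℝ × ℝ => U q.1 q.2) (Icc 0 s ×ˢ Icc 0 1)
  boundary_left : ∀ t ∈ Icc 0 s, U t 0 = 0
  boundary_right : ∀ t ∈ Icc 0 s, U t 1 = 0
  equation : ∀ t ∈ Ioc 0 s, ∀ x ∈ Ioo (0 : ℝ) 1, ∃ a b, HasDerivAt (fun r => U r x) a t ∧
    (∀ y ∈ Ioo (0 : ℝ) 1, DifferentiableAt ℝ (U t) y) ∧ HasDerivAt (deriv (U t)) b x ∧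
    a = b + F (U t x)

lemma IsClassicalOn.sub_le_zero {F : ℝ → ℝ} {L s : ℝ} {U V : ℝ → ℝ → ℝ}
    (hF : ∀ r r', |F r - F r'| ≤ L * |r - r'|) (hU : IsClassicalOn F s U)
    (hV : IsClassicalOn F s V) (h0 : ∀ x ∈ Icc (0 : ℝ) 1, U 0 x = V 0 x) :
    ∀ t ∈ Icc 0 s, ∀ x ∈ Icc (0 : ℝ) 1, U t x - V t x ≤ 0 := by
  refine nonpos_of_differential_inequality (w := fun t x => U t x - V t x) (L := L)
    (hU.continuousOn.sub hV.continuousOn) (fun x hx => (sub_eq_zero.2 (h0 x hx)).le)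
    (fun t ht => by simp [hU.boundary_left t ht, hV.boundary_left t ht])
    (fun t ht => by simp [hU.boundary_right t ht, hV.boundary_right t ht]) fun t ht x hx => ?_
  obtain ⟨a, b, ha, hUd, hb, hab⟩ := hU.equation t ht x hx
  obtain ⟨a', b', ha', hVd, hb', hab'⟩ := hV.equation t ht x hx
  refine ⟨a - a', b - b', ha.sub ha', (hb.sub hb').congr_of_eventuallyEq ?_, ?_⟩
  · filter_upwards [Ioo_mem_nhds hx.1 hx.2] with y hy
    exact deriv_fun_sub (hUd y hy) (hVd y hy)
  · have := (le_abs_self _).trans (hF (U t x) (V t x))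
    linarith

lemma IsClassicalOn.eq {F : ℝ → ℝ} {L s : ℝ} {U V : ℝ → ℝ → ℝ}
    (hF : ∀ r r', |F r - F r'| ≤ L * |r - r'|) (hU : IsClassicalOn F s U)
    (hV : IsClassicalOn F s V) (h0 : ∀ x ∈ Icc (0 : ℝ) 1, U 0 x = V 0 x) {t x : ℝ}
    (ht : t ∈ Icc 0 s) (hx : x ∈ Icc (0 : ℝ) 1) : U t x = V t x :=
  le_antisymm (sub_nonpos.1 (hU.sub_le_zero hF hV h0 t ht x hx))
    (sub_nonpos.1 (hV.sub_le_zero hF hU (fun x hx => (h0 x hx).symm) t ht x hx))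

lemma IsDer.deriv_eq {φ ψ : Per} (h : IsDer φ ψ) :
    (deriv fun y : ℝ => φ (y : AddCircle (2 : ℝ))) = fun y : ℝ => ψ (y : AddCircle (2 : ℝ)) :=
  funext fun y => (h y).deriv

lemma hasDerivAt_apply {u : ℝ → Per} {u' : Per} {t : ℝ} (h : HasDerivAt u u' t) (x : ℝ) :
    HasDerivAt (fun r => u r (x : AddCircle (2 : ℝ))) (u' (x : AddCircle (2 : ℝ))) t :=
  (evalCLM x).hasFDerivAt.comp_hasDerivAt t h

lemma continuousOn_uncurry_apply {u : ℝ → Per} {s : Set ℝ} (h : ContinuousOn u s) (A : Set ℝ) :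
    ContinuousOn (fun q : ℝ × ℝ => u q.1 (q.2 : AddCircle (2 : ℝ))) (s ×ˢ A) := by
  have h1 : Continuous fun q : Per × ℝ => q.1 (q.2 : AddCircle (2 : ℝ)) :=
    ContinuousEval.continuous_eval.comp (continuous_fst.prodMk
      ((AddCircle.continuous_mk' 2).comp continuous_snd))
  exact h1.comp_continuousOn (f := fun q : ℝ × ℝ => (u q.1, q.2))
    ((h.comp continuousOn_fst fun q hq => hq.1).prodMk continuousOn_snd)

lemma IsRegular.isClassicalOn {F : C(ℝ, ℝ)} {T s : ℝ} {u : ℝ → Per} (hu : IsRegular F T u)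
    (hs : s < T) : IsClassicalOn F s fun t x => u t (x : AddCircle (2 : ℝ)) where
  continuousOn := continuousOn_uncurry_apply
    (hu.continuousOn.mono fun t ht => ⟨ht.1, ht.2.trans_lt hs⟩) _
  boundary_left t ht := apply_zero_of_reflect (hu.reflect_eq t ⟨ht.1, ht.2.trans_lt hs⟩)
  boundary_right t ht := apply_one_of_reflect (hu.reflect_eq t ⟨ht.1, ht.2.trans_lt hs⟩)
  equation t ht x _ := by
    have ht' : t ∈ Ioo 0 T := ⟨ht.1, ht.2.trans_lt hs⟩
    refine ⟨_, _, hasDerivAt_apply (hu.hasDerivAt t ht') x,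
      fun y _ => (hu.isDer t ht' y).differentiableAt, ?_, rfl⟩
    rw [(hu.isDer t ht').deriv_eq]
    exact hu.isDer_der t ht' x

lemma IsRegular.isSolution {p : ℝ} (hp : 1 < p) {T : ℝ} {w : ℝ → Per} {u : DirichletData}
    (hw : IsRegular (sourceMap hp) T w) (h0 : w 0 = oddExt u) :
    IsSolution p u T fun t x => w t (x : AddCircle (2 : ℝ)) where
  continuousOn := continuousOn_uncurry_apply hw.continuousOn _
  initial x := by rw [h0, oddExt_apply]
  boundary_left t ht := apply_zero_of_reflect (hw.reflect_eq t ht)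
  boundary_right t ht := apply_one_of_reflect (hw.reflect_eq t ht)
  differentiableAt_time t ht x _ := (hasDerivAt_apply (hw.hasDerivAt t ht) x).differentiableAt
  differentiableAt_space t ht x _ := (hw.isDer t ht x).differentiableAt
  differentiableAt_deriv_space t ht x _ := by
    rw [(hw.isDer t ht).deriv_eq]
    exact (hw.isDer_der t ht x).differentiableAt
  equation t ht x _ := by
    rw [(hasDerivAt_apply (hw.hasDerivAt t ht) x).deriv, (hw.isDer t ht).deriv_eq,
      (hw.isDer_der t ht x).deriv]
    rfl

lemma IsSolution.isClassicalOn_trunc {p : ℝ} (hp : 1 < p) {u : DirichletData} {T s M : ℝ}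
    {U : ℝ → ℝ → ℝ} (hU : IsSolution p u T U) (hs : s < T)
    (hM : ∀ t ∈ Icc 0 s, ∀ x ∈ Icc (0 : ℝ) 1, |U t x| ≤ M) :
    IsClassicalOn (trunc hp M) s U where
  continuousOn := hU.continuousOn.mono
    (prod_mono (fun t ht => ⟨ht.1, ht.2.trans_lt hs⟩) Subset.rfl)
  boundary_left t ht := hU.boundary_left t ⟨ht.1, ht.2.trans_lt hs⟩
  boundary_right t ht := hU.boundary_right t ⟨ht.1, ht.2.trans_lt hs⟩
  equation t ht x hx := by
    have ht' : t ∈ Ioo 0 T := ⟨ht.1, ht.2.trans_lt hs⟩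
    refine ⟨_, _, (hU.differentiableAt_time t ht' x hx).hasDerivAt,
      fun y hy => hU.differentiableAt_space t ht' y hy,
      (hU.differentiableAt_deriv_space t ht' x hx).hasDerivAt, ?_⟩
    rw [hU.equation t ht' x hx,
      trunc_eq_source hp (hM t ⟨ht.1.le, ht.2⟩ x ⟨hx.1.le, hx.2.le⟩)]

lemma IsRegular.of_trunc {p : ℝ} (hp : 1 < p) {M T : ℝ} {w : ℝ → Per}
    (hw : IsRegular (trunc hp M) T w) (hM : ∀ t ∈ Ico 0 T, ‖w t‖ ≤ M) :
    IsRegular (sourceMap hp) T w where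
  continuousOn := hw.continuousOn
  isDer := hw.isDer
  isDer_der := hw.isDer_der
  continuousOn_der := hw.continuousOn_der
  continuousOn_der_der := hw.continuousOn_der_der
  hasDerivAt t ht := by
    rw [← trunc_comp_eq hp (hM t ⟨ht.1.le, ht.2⟩)]
    exact hw.hasDerivAt t ht
  reflect_eq := hw.reflect_eq
  norm_le s t hs hst ht := by
    refine (hw.norm_le s t hs hst ht).trans (le_of_eq ?_)
    congr 1
    refine intervalIntegral.integral_congr fun r hr => ?_
    rw [uIcc_of_le hst] at hr
    rw [trunc_comp_eq hp (hM r ⟨hs.trans hr.1, hr.2.trans_lt ht⟩)]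

/-! ### Truncated solutions and the explosion time -/

/-- The Lipschitz constant of the source term truncated at level `M`. -/
def truncLip (p M : ℝ) : ℝ := p * M ^ (p - 1)

/-- The global mild solution for the source term truncated at level `M`. -/
def truncSol {p : ℝ} (hp : 1 < p) (M : ℝ) (u : DirichletData) : ℝ → Per :=
  Classical.epsilon fun w => IsMild (trunc hp M) (2 * truncLip p M) (oddExt u) w

lemma isMild_truncSol {p : ℝ} (hp : 1 < p) {M : ℝ} (hM : 0 < M) (u : DirichletData) :
    IsMild (trunc hp M) (2 * truncLip p M) (oddExt u) (truncSol hp M u) :=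
  Classical.epsilon_spec ((isTame_trunc hp hM).exists_isMild (oddExt u))

lemma isRegular_truncSol {p : ℝ} (hp : 1 < p) {M : ℝ} (hM : 0 < M) (u : DirichletData) (T : ℝ) :
    IsRegular (trunc hp M) T (truncSol hp M u) :=
  (isTame_trunc hp hM).isRegular (isMild_truncSol hp hM u) (reflect_oddExt u) T

/-- The truncation at level `M` is inactive on `[0,s]`. -/
def IsGood {p : ℝ} (hp : 1 < p) (M : ℝ) (u : DirichletData) (s : ℝ) : Prop :=
  0 < M ∧ ∀ t ∈ Icc 0 s, ‖truncSol hp M u t‖ < M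

lemma IsGood.mono {p : ℝ} {hp : 1 < p} {M : ℝ} {u : DirichletData} {s s' : ℝ}
    (h : IsGood hp M u s) (hs : s' ≤ s) : IsGood hp M u s' :=
  ⟨h.1, fun t ht => h.2 t ⟨ht.1, ht.2.trans hs⟩⟩

/-- The strict inequality in `IsGood` makes it an open condition in time, hence the strict
inequality in `IsGood.lt_explosionTime`. -/
lemma IsGood.exists_lt {p : ℝ} {hp : 1 < p} {M : ℝ} {u : DirichletData} {s : ℝ} (hs : 0 ≤ s)
    (h : IsGood hp M u s) : ∃ s', s < s' ∧ IsGood hp M u s' := by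
  have h1 : ∀ᶠ t in 𝓝 s, ‖truncSol hp M u t‖ < M :=
    ((isMild_truncSol hp h.1 u).continuous.norm.tendsto s).eventually_lt_const
      (h.2 s ⟨hs, le_rfl⟩)
  obtain ⟨ε, hε, hε'⟩ := Metric.eventually_nhds_iff.1 h1
  refine ⟨s + ε / 2, by linarith, h.1, fun t ht => ?_⟩
  rcases le_total t s with hts | hts
  · exact h.2 t ⟨ht.1, hts⟩
  · refine hε' ?_
    rw [Real.dist_eq, abs_of_nonneg (by linarith)]
    linarith [ht.2]

lemma IsGood.isSolution {p : ℝ} {hp : 1 < p} {M : ℝ} {u : DirichletData} {s : ℝ}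
    (h : IsGood hp M u s) :
    IsSolution p u s fun t x => truncSol hp M u t (x : AddCircle (2 : ℝ)) :=
  ((isRegular_truncSol hp h.1 u s).of_trunc hp fun t ht => (h.2 t ⟨ht.1, ht.2.le⟩).le).isSolution
    hp (isMild_truncSol hp h.1 u).apply_zero

lemma IsGood.lt_explosionTime {p : ℝ} {hp : 1 < p} {M : ℝ} {u : DirichletData} {s : ℝ}
    (hs : 0 ≤ s) (h : IsGood hp M u s) : ENNReal.ofReal s < explosionTime p u := by
  obtain ⟨s', hs', h'⟩ := h.exists_lt hs
  have h0 : 0 < s' := hs.trans_lt hs'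
  exact ((ENNReal.ofReal_lt_ofReal_iff h0).2 hs').trans_le
    (le_sSup ⟨s', h0, ⟨_, h'.isSolution⟩, rfl⟩)

lemma IsSolution.eq_truncSol {p : ℝ} (hp : 1 < p) {u : DirichletData} {T s M : ℝ}
    {U : ℝ → ℝ → ℝ} (hU : IsSolution p u T U) (hs : s < T) (hM0 : 0 < M)
    (hM : ∀ t ∈ Icc 0 s, ∀ x ∈ Icc (0 : ℝ) 1, |U t x| ≤ M) {t x : ℝ} (ht : t ∈ Icc 0 s)
    (hx : x ∈ Icc (0 : ℝ) 1) : truncSol hp M u t (x : AddCircle (2 : ℝ)) = U t x := by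
  refine ((isRegular_truncSol hp hM0 u T).isClassicalOn hs).eq (isTame_trunc hp hM0).abs_sub_le
    (hU.isClassicalOn_trunc hp hs hM) (fun y hy => ?_) ht hx
  rw [(isMild_truncSol hp hM0 u).apply_zero, hU.initial ⟨y, hy⟩]
  exact oddExt_apply u ⟨y, hy⟩

/-- A classical solution is bounded on the compact set `[0,s] × [0,1]`, so for a higher level it
solves the truncated problem and equals `truncSol` by uniqueness. Together with
`IsGood.lt_explosionTime` this translates `explosionTime` into a statement about truncated
solutions. -/
lemma IsSolution.exists_isGood {p : ℝ} (hp : 1 < p) {u : DirichletData} {T s : ℝ}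
    {U : ℝ → ℝ → ℝ} (hU : IsSolution p u T U) (hs : s < T) : ∃ M, IsGood hp M u s := by
  have hc : ContinuousOn (fun q : ℝ × ℝ => U q.1 q.2) (Icc 0 s ×ˢ Icc 0 1) :=
    hU.continuousOn.mono (prod_mono (fun t ht => ⟨ht.1, ht.2.trans_lt hs⟩) Subset.rfl)
  obtain ⟨C, hC⟩ := (isCompact_Icc.prod isCompact_Icc).exists_bound_of_continuousOn hc
  have hC' : ∀ t ∈ Icc 0 s, ∀ x ∈ Icc (0 : ℝ) 1, |U t x| ≤ |C| := fun t ht x hx =>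
    (hC (t, x) ⟨ht, hx⟩).trans (le_abs_self C)
  have hM0 : 0 < |C| + 1 := by positivity
  refine ⟨|C| + 1, hM0, fun t ht => ?_⟩
  refine (norm_le_of_reflect ((isRegular_truncSol hp hM0 u T).reflect_eq t
    ⟨ht.1, ht.2.trans_lt hs⟩) (abs_nonneg C) fun x hx => ?_).trans_lt (lt_add_one _)
  rw [hU.eq_truncSol hp hs hM0 (fun t ht x hx => (hC' t ht x hx).trans (by linarith)) ht hx]
  exact hC' t ht x hx

lemma exists_isGood {p : ℝ} (hp : 1 < p) {u : DirichletData} {s : ℝ}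
    (hs : ENNReal.ofReal s < explosionTime p u) : ∃ M, IsGood hp M u s := by
  obtain ⟨_, ⟨T, hT, ⟨U, hU⟩, rfl⟩, hlt⟩ := lt_sSup_iff.1 hs
  exact hU.exists_isGood hp ((ENNReal.ofReal_lt_ofReal_iff hT).1 hlt)

lemma ext_of_reflect {φ ψ : Per} (hφ : reflect φ = φ) (hψ : reflect ψ = ψ)
    (h : ∀ x ∈ Icc (0 : ℝ) 1, φ (x : AddCircle (2 : ℝ)) = ψ (x : AddCircle (2 : ℝ))) : φ = ψ := by
  ext x
  obtain ⟨y, hy, rfl⟩ := exists_coe_Icc x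
  rcases le_total 0 y with h0 | h0
  · exact h y ⟨h0, hy.2⟩
  · have := h (-y) ⟨by linarith, by linarith [hy.1]⟩
    rw [AddCircle.coe_neg, apply_neg_of_reflect hφ, apply_neg_of_reflect hψ] at this
    linarith

/-- A regular solution agrees with the truncated solution as long as the truncation is inactive
on it. -/
lemma IsRegular.eq_truncSol {p : ℝ} (hp : 1 < p) {u : DirichletData} {T s M : ℝ} {w : ℝ → Per}
    (hw : IsRegular (sourceMap hp) T w) (h0 : w 0 = oddExt u) (hs : s < T) (hM0 : 0 < M)
    (hM : ∀ t ∈ Icc 0 s, ‖w t‖ ≤ M) {t : ℝ} (ht : t ∈ Icc 0 s) : truncSol hp M u t = w t :=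
  ext_of_reflect ((isRegular_truncSol hp hM0 u T).reflect_eq t ⟨ht.1, ht.2.trans_lt hs⟩)
    (hw.reflect_eq t ⟨ht.1, ht.2.trans_lt hs⟩) fun _ hx =>
    (hw.isSolution hp h0).eq_truncSol hp hs hM0
      (fun t ht _ _ => ((w t).norm_coe_le_norm _).trans (hM t ht)) ht hx

lemma IsGood.eq_of_le {p : ℝ} {hp : 1 < p} {M M' : ℝ} {u : DirichletData} {s : ℝ}
    (h : IsGood hp M u s) (hMM' : M ≤ M') {t : ℝ} (ht : t ∈ Icc 0 s) :
    truncSol hp M' u t = truncSol hp M u t := by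
  obtain ⟨s', hs', h'⟩ := h.exists_lt (ht.1.trans ht.2)
  have hreg := (isRegular_truncSol hp h.1 u s').of_trunc hp
    fun t ht => (h'.2 t ⟨ht.1, ht.2.le⟩).le
  exact hreg.eq_truncSol hp (isMild_truncSol hp h.1 u).apply_zero hs' (h.1.trans_le hMM')
    (fun t ht => (h.2 t ht).le.trans hMM') ht

lemma IsGood.eq {p : ℝ} {hp : 1 < p} {M M' : ℝ} {u : DirichletData} {s : ℝ}
    (h : IsGood hp M u s) (h' : IsGood hp M' u s) {t : ℝ} (ht : t ∈ Icc 0 s) :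
    truncSol hp M' u t = truncSol hp M u t := by
  rcases le_total M M' with hle | hle
  · exact h.eq_of_le hle ht
  · exact (h'.eq_of_le hle ht).symm

/-- A solution which stays bounded up to time `T` does not explode at time `T`. -/
lemma IsRegular.lt_explosionTime {p : ℝ} (hp : 1 < p) {u : DirichletData} {T B : ℝ} {w : ℝ → Per}
    (hT : 0 < T) (hw : IsRegular (sourceMap hp) T w) (h0 : w 0 = oddExt u)
    (hB : ∀ t ∈ Ico 0 T, ‖w t‖ ≤ B) : ENNReal.ofReal T < explosionTime p u := by
  have hB0 : 0 ≤ B := (norm_nonneg _).trans (hB 0 ⟨le_rfl, hT⟩)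
  have hM0 : 0 < B + 1 := by linarith
  have h1 : ∀ t ∈ Ico 0 T, ‖truncSol hp (B + 1) u t‖ ≤ B := fun t ht => by
    rw [hw.eq_truncSol hp h0 ht.2 hM0 (fun r hr => (hB r ⟨hr.1, hr.2.trans_lt ht.2⟩).trans
      (by linarith)) ⟨ht.1, le_rfl⟩]
    exact hB t ht
  -- The truncated solution is global and continuous, so the bound passes to the closed interval.
  have h2 : ‖truncSol hp (B + 1) u T‖ ≤ B := by
    have hc := ((isMild_truncSol hp hM0 u).continuous.norm.tendsto T).mono_left
      (nhdsWithin_le_nhds (s := Iio T))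
    refine le_of_tendsto hc ?_
    filter_upwards [Ioo_mem_nhdsLT hT] with t ht
    exact h1 t ⟨ht.1.le, ht.2⟩
  have h3 : IsGood hp (B + 1) u T := ⟨hM0, fun t ht => by
    rcases eq_or_lt_of_le ht.2 with rfl | h
    · linarith
    · linarith [h1 t ⟨ht.1, h⟩]⟩
  exact h3.lt_explosionTime hT.le

/-- The maximal solution is regular, and locally a truncated solution. -/
lemma exists_isRegular {p : ℝ} (hp : 1 < p) {u : DirichletData} {T : ℝ} (hT : 0 < T)
    (h : ENNReal.ofReal T ≤ explosionTime p u) :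
    ∃ w, IsRegular (sourceMap hp) T w ∧ w 0 = oddExt u ∧
      ∀ M s, s < T → IsGood hp M u s → ∀ t ∈ Icc 0 s, w t = truncSol hp M u t := by
  have hgood : ∀ t, ∃ M, t < T → IsGood hp M u t := fun t => by
    by_cases ht : t < T
    · obtain ⟨M, hM⟩ := exists_isGood hp (((ENNReal.ofReal_lt_ofReal_iff hT).2 ht).trans_le h)
      exact ⟨M, fun _ => hM⟩
    · exact ⟨0, fun h => absurd h ht⟩
  choose M hM using hgood
  -- The level varies with `t`, but two good levels give the same value, so near each time `w` is a
  -- single truncated solution.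
  set w : ℝ → Per := fun t => truncSol hp (M t) u t with hw
  have heq : ∀ M' s, s < T → IsGood hp M' u s → ∀ t ∈ Icc 0 s, w t = truncSol hp M' u t :=
    fun M' s hs hg t ht => (hg.mono ht.2).eq (hM t (ht.2.trans_lt hs)) ⟨ht.1, le_rfl⟩
  have hreg : ∀ s, s < T → IsRegular (sourceMap hp) s (truncSol hp (M s) u) := fun s hs =>
    (isRegular_truncSol hp (hM s hs).1 u s).of_trunc hp
      fun t ht => ((hM s hs).2 t ⟨ht.1, ht.2.le⟩).le
  have heqs : ∀ s, s < T → ∀ t ∈ Icc 0 s, w t = truncSol hp (M s) u t :=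
    fun s hs => heq (M s) s hs (hM s hs)
  have hloc : ∀ t ∈ Ioo 0 T, ∃ s, s < T ∧ t ∈ Ioo 0 s ∧ w =ᶠ[𝓝 t] truncSol hp (M s) u := by
    intro t ht
    obtain ⟨s, hts, hsT⟩ := exists_between ht.2
    refine ⟨s, hsT, ⟨ht.1, hts⟩, ?_⟩
    filter_upwards [Ioo_mem_nhds ht.1 hts] with r hr
    exact heqs s hsT r ⟨hr.1.le, hr.2.le⟩
  refine ⟨w, ⟨?_, ?_, ?_, ?_, ?_, ?_, ?_, ?_⟩, ?_, heq⟩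
  · intro t ht
    obtain ⟨s, hts, hsT⟩ := exists_between ht.2
    have hc := (isMild_truncSol hp (hM s hsT).1 u).continuous.continuousWithinAt
      (s := Ico 0 T) (x := t)
    refine hc.congr_of_eventuallyEq ?_ (heqs s hsT t ⟨ht.1, hts.le⟩)
    filter_upwards [self_mem_nhdsWithin, nhdsWithin_le_nhds (gt_mem_nhds hts)] with r hr hrs
    exact heqs s hsT r ⟨hr.1, le_of_lt hrs⟩
  · intro t ht
    obtain ⟨s, hs, hts, he⟩ := hloc t ht
    rw [he.eq_of_nhds]
    exact (hreg s hs).isDer t hts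
  · intro t ht
    obtain ⟨s, hs, hts, he⟩ := hloc t ht
    rw [he.eq_of_nhds]
    exact (hreg s hs).isDer_der t hts
  · intro t ht
    obtain ⟨s, hs, hts, he⟩ := hloc t ht
    refine (((hreg s hs).continuousOn_der.continuousAt (Ioo_mem_nhds hts.1 hts.2)).congr
      ?_).continuousWithinAt
    filter_upwards [he] with r hr
    rw [hr]
  · intro t ht
    obtain ⟨s, hs, hts, he⟩ := hloc t ht
    refine (((hreg s hs).continuousOn_der_der.continuousAt (Ioo_mem_nhds hts.1 hts.2)).congr
      ?_).continuousWithinAt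
    filter_upwards [he] with r hr
    rw [hr]
  · intro t ht
    obtain ⟨s, hs, hts, he⟩ := hloc t ht
    rw [he.eq_of_nhds]
    exact ((hreg s hs).hasDerivAt t hts).congr_of_eventuallyEq he
  · intro t ht
    obtain ⟨s, hts, hsT⟩ := exists_between ht.2
    rw [heqs s hsT t ⟨ht.1, hts.le⟩]
    exact (hreg s hsT).reflect_eq t ⟨ht.1, hts⟩
  · intro s t hs hst ht
    obtain ⟨r, htr, hrT⟩ := exists_between ht
    have h1 := (hreg r hrT).norm_le s t hs hst htr
    rw [← heqs r hrT t ⟨hs.trans hst, htr.le⟩, ← heqs r hrT s ⟨hs, hst.trans htr.le⟩] at h1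
    refine h1.trans (le_of_eq ?_)
    congr 1
    refine intervalIntegral.integral_congr fun q hq => ?_
    rw [uIcc_of_le hst] at hq
    rw [heqs r hrT q ⟨hs.trans hq.1, hq.2.trans htr.le⟩]
  · exact (isMild_truncSol hp (hM 0 hT).1 u).apply_zero

/-! ### Lower semicontinuity -/

/-- On the compact interval `[0,s]` the norm stays below `M` by a gap `δ`, and Lipschitz dependence
keeps nearby truncated solutions within `δ`. -/
lemma IsGood.eventually {p : ℝ} {hp : 1 < p} {M : ℝ} {u : DirichletData} {s : ℝ}
    (h : IsGood hp M u s) : ∀ᶠ v in 𝓝 u, IsGood hp M v s := by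
  rcases lt_or_ge s 0 with hs | hs
  · exact Eventually.of_forall fun v => ⟨h.1, fun t ht => absurd (ht.1.trans ht.2) (not_le.2 hs)⟩
  have hcont := (isMild_truncSol hp h.1 u).continuous.norm
  obtain ⟨t₀, ht₀, hmax⟩ := isCompact_Icc.exists_isMaxOn (nonempty_Icc.2 hs) hcont.continuousOn
  set δ := M - ‖truncSol hp M u t₀‖ with hδ
  have hδ0 : 0 < δ := sub_pos.2 (h.2 t₀ ht₀)
  have hL := (isTame_trunc hp h.1).pos
  have hlim : Tendsto (fun v : DirichletData =>
      2 * dist v u * Real.exp (2 * truncLip p M * s)) (𝓝 u) (𝓝 0) := by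
    have hc : Continuous fun v : DirichletData =>
      2 * dist v u * Real.exp (2 * truncLip p M * s) := by fun_prop
    simpa using hc.tendsto u
  filter_upwards [hlim.eventually_lt_const hδ0] with v hv
  refine ⟨h.1, fun t ht => ?_⟩
  have h1 := (isTame_trunc hp h.1).norm_sub_le_of_isMild (isMild_truncSol hp h.1 v)
    (isMild_truncSol hp h.1 u) ht.1
  have h2 : 2 * ‖oddExt v - oddExt u‖ * Real.exp (2 * (p * M ^ (p - 1)) * t) ≤
      2 * dist v u * Real.exp (2 * truncLip p M * s) := by
    have := norm_oddExt_sub_le v u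
    have h3 : 2 * (p * M ^ (p - 1)) * t ≤ 2 * truncLip p M * s :=
      mul_le_mul_of_nonneg_left ht.2 (mul_nonneg zero_le_two hL.le)
    gcongr
  have h3 : ‖truncSol hp M u t‖ ≤ ‖truncSol hp M u t₀‖ := hmax ht
  have h4 := norm_sub_norm_le (truncSol hp M v t) (truncSol hp M u t)
  linarith

/-! ### Energy identities -/

/-- The integral over one period. -/
def perInt : Per →L[ℝ] ℝ := integralCLM 0 2

lemma perInt_apply (φ : Per) : perInt φ = ∫ x in (0 : ℝ)..2, φ (x : AddCircle (2 : ℝ)) := rfl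

lemma perInt_mono {φ ψ : Per} (h : ∀ x, φ x ≤ ψ x) : perInt φ ≤ perInt ψ :=
  intervalIntegral.integral_mono zero_le_two ((continuous_coe_apply φ).intervalIntegrable _ _)
    ((continuous_coe_apply ψ).intervalIntegrable _ _) fun x => h x

lemma perInt_nonneg {φ : Per} (h : ∀ x, 0 ≤ φ x) : 0 ≤ perInt φ :=
  intervalIntegral.integral_nonneg zero_le_two fun x _ => h x

lemma perInt_mul_self_nonneg (φ : Per) : 0 ≤ perInt (φ * φ) :=
  perInt_nonneg fun x => mul_self_nonneg (φ x)

lemma perInt_two_mul_le (φ ψ : Per) :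
    2 * perInt (φ * ψ) ≤ perInt (φ * φ) + perInt (ψ * ψ) := by
  rw [← smul_eq_mul, ← map_smul, ← map_add]
  refine perInt_mono fun x => ?_
  simp only [ContinuousMap.smul_apply, ContinuousMap.mul_apply, ContinuousMap.add_apply,
    smul_eq_mul]
  nlinarith [sq_nonneg (φ x - ψ x)]

lemma IsDer.mul {φ φ' ψ ψ' : Per} (h : IsDer φ φ') (h' : IsDer ψ ψ') :
    IsDer (φ * ψ) (φ' * ψ + φ * ψ') := fun x => (h x).mul (h' x)

lemma IsDer.perInt_eq_zero {φ ψ : Per} (h : IsDer φ ψ) : perInt ψ = 0 := by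
  rw [perInt_apply, ← h.sub_eq 0 2, AddCircle.coe_period, AddCircle.coe_zero, sub_self]

/-- Integration by parts; periodicity leaves no boundary terms. -/
lemma IsDer.perInt_mul {φ φ' ψ ψ' : Per} (h : IsDer φ φ') (h' : IsDer ψ ψ') :
    perInt (φ' * ψ) = -perInt (φ * ψ') := by
  have := (h.mul h').perInt_eq_zero
  rw [map_add] at this
  linarith

lemma IsDer.sub {φ ψ φ' ψ' : Per} (h : IsDer φ ψ) (h' : IsDer φ' ψ') :
    IsDer (φ - φ') (ψ - ψ') := fun x => (h x).sub (h' x)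

/-- A product rule asking only continuity of `q`, because the other factor vanishes at `t`. -/
lemma hasDerivAt_sub_mul {w q : ℝ → Per} {w' : Per} {t : ℝ} (hw : HasDerivAt w w' t)
    (hq : ContinuousAt q t) : HasDerivAt (fun s => (w s - w t) * q s) (w' * q t) t := by
  rw [hasDerivAt_iff_tendsto_slope] at hw ⊢
  refine (hw.mul (hq.mono_left nhdsWithin_le_nhds)).congr fun s => ?_
  simp [slope]

/-- Mixed derivatives in `t` and `x` are avoided: the increment of `∫ w_x²` is a difference times a
sum, and integrating it by parts gives `-∫ (w(s) - w(t)) (w_xx(s) + w_xx(t))`. -/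
lemma hasDerivAt_perInt_der_mul_der {w : ℝ → Per} {w' : Per} {t : ℝ} (hw : HasDerivAt w w' t)
    (h1 : ∀ᶠ s in 𝓝 t, IsDer (w s) (der (w s)))
    (h2 : ∀ᶠ s in 𝓝 t, IsDer (der (w s)) (der (der (w s))))
    (h3 : ContinuousAt (fun s => der (der (w s))) t) :
    HasDerivAt (fun s => perInt (der (w s) * der (w s))) (-(2 * perInt (w' * der (der (w t))))) t := by
  have h4 := hasDerivAt_sub_mul (q := fun s => der (der (w s)) + der (der (w t))) hw
    (h3.add continuousAt_const)
  have h5 := ((perInt.hasFDerivAt.comp_hasDerivAt t h4).const_sub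
    (perInt (der (w t) * der (w t))))
  refine (h5.congr_deriv ?_).congr_of_eventuallyEq ?_
  · rw [mul_add, map_add]; ring
  · filter_upwards [h1, h2] with s hs1 hs2
    have h6 := ((hs1.sub h1.self_of_nhds).perInt_mul (hs2.add h2.self_of_nhds))
    have h7 : (der (w s) - der (w t)) * (der (w s) + der (w t)) =
        der (w s) * der (w s) - der (w t) * der (w t) := by ring
    rw [h7, map_sub] at h6
    simp only [Function.comp]
    linarith

/-- A quadratic Taylor remainder, uniform on `[-R, R]`; it makes composition with the potential
differentiable in the supremum norm. -/
lemma abs_potential_sub_le {p : ℝ} (hp : 1 < p) {R a h : ℝ} (hR : 0 < R) (ha : |a| ≤ R)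
    (hah : |a + h| ≤ R) :
    |potential p (a + h) - potential p a - source p a * h| ≤ p * R ^ (p - 1) * h ^ 2 := by
  have hL := (isTame_trunc hp hR).pos
  have key := Convex.norm_image_sub_le_of_norm_hasDerivWithin_le (s := uIcc a (a + h))
    (f := fun r => potential p r - source p a * r) (f' := fun r => source p r - source p a)
    (C := p * R ^ (p - 1) * |h|) (x := a) (y := a + h) (fun r _ => by
      have := (hasDerivAt_potential hp r).sub ((hasDerivAt_id r).const_mul (source p a))
      rw [mul_one] at this
      exact this.hasDerivWithinAt) (fun r hr => by
      have h1 : |r - a| ≤ |h| := by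
        have := abs_sub_left_of_mem_uIcc hr
        simpa using this
      have h2 : |r| ≤ R := by
        have h3 : uIcc a (a + h) ⊆ Icc (-R) R :=
          uIcc_subset_Icc (abs_le.1 ha) (abs_le.1 hah)
        exact abs_le.2 (h3 hr)
      exact (abs_source_sub_le hp hR h2 ha).trans (mul_le_mul_of_nonneg_left h1 hL.le))
    (convex_uIcc _ _) left_mem_uIcc right_mem_uIcc
  simp only [Real.norm_eq_abs] at key
  have e1 : potential p (a + h) - source p a * (a + h) - (potential p a - source p a * a) =
      potential p (a + h) - potential p a - source p a * h := by ring
  have e2 : p * R ^ (p - 1) * |h| * |a + h - a| = p * R ^ (p - 1) * h ^ 2 := by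
    rw [add_sub_cancel_left, mul_assoc, abs_mul_abs_self, sq]
  rwa [e1, e2] at key

lemma hasDerivAt_potential_comp {p : ℝ} (hp : 1 < p) {w : ℝ → Per} {w' : Per} {t : ℝ}
    (hw : HasDerivAt w w' t) :
    HasDerivAt (fun s => (potentialMap hp).comp (w s)) ((sourceMap hp).comp (w t) * w') t := by
  have hF : HasFDerivAt (fun φ : Per => (potentialMap hp).comp φ)
      (ContinuousLinearMap.mul ℝ Per ((sourceMap hp).comp (w t))) (w t) := by
    rw [hasFDerivAt_iff_isLittleO_nhds_zero]
    set R := ‖w t‖ + 1 with hR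
    have hR0 : 0 < R := by positivity
    have h1 : (fun h : Per => (potentialMap hp).comp (w t + h) - (potentialMap hp).comp (w t) -
        ContinuousLinearMap.mul ℝ Per ((sourceMap hp).comp (w t)) h) =O[𝓝 0]
        fun h => ‖h‖ ^ 2 := by
      refine Asymptotics.IsBigO.of_bound (p * R ^ (p - 1)) ?_
      filter_upwards [Metric.ball_mem_nhds (0 : Per) one_pos] with h hh
      rw [mem_ball_zero_iff] at hh
      rw [norm_pow, norm_norm]
      have hL := (isTame_trunc hp hR0).pos
      refine (ContinuousMap.norm_le _ (by positivity)).2 fun x => ?_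
      have ha : |w t x| ≤ R := ((w t).norm_coe_le_norm x).trans (by linarith)
      have hb : |h x| ≤ ‖h‖ := h.norm_coe_le_norm x
      have hab : |w t x + h x| ≤ R := by
        refine (abs_add_le _ _).trans ?_
        have : |w t x| ≤ ‖w t‖ := (w t).norm_coe_le_norm x
        linarith
      refine (abs_potential_sub_le hp hR0 ha hab).trans ?_
      rw [← sq_abs (h x)]
      gcongr
    exact h1.trans_isLittleO (Asymptotics.isLittleO_norm_pow_id one_lt_two)
  exact hF.comp_hasDerivAt t hw

/-- The energy `½ ∫ φ'² - ∫ |φ|^(p+1)/(p+1)` over one period. -/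
def energy {p : ℝ} (hp : 1 < p) (φ : Per) : ℝ :=
  1 / 2 * perInt (der φ * der φ) - perInt ((potentialMap hp).comp φ)

/-- The time derivative of a solution, as given by the equation. -/
def velocity {p : ℝ} (hp : 1 < p) (φ : Per) : Per := der (der φ) + (sourceMap hp).comp φ

/-- The squared `L²` norm of the time derivative. -/
def dissipation {p : ℝ} (hp : 1 < p) (φ : Per) : ℝ := perInt (velocity hp φ * velocity hp φ)

lemma mul_source_eq {p : ℝ} (hp : 1 < p) (r : ℝ) : r * source p r = (p + 1) * potential p r := by
  have h1 : p + 1 ≠ 0 := by linarith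
  rw [potential, mul_div_cancel₀ _ h1, source]
  rcases eq_or_ne r 0 with rfl | hr
  · rw [abs_zero, Real.zero_rpow h1]; ring
  · have : |r| ^ (p + 1) = |r| ^ (p - 1) * |r| ^ (2 : ℝ) := by
      rw [← Real.rpow_add (abs_pos.2 hr)]; ring_nf
    rw [this, Real.rpow_two, sq_abs]; ring

namespace IsRegular

/-- The velocity is minus the `L²` gradient of the energy. -/
lemma hasDerivAt_energy {p : ℝ} {hp : 1 < p} {T : ℝ} {w : ℝ → Per}
    (hw : IsRegular (sourceMap hp) T w) {t : ℝ} (ht : t ∈ Ioo 0 T) :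
    HasDerivAt (fun s => energy hp (w s)) (-dissipation hp (w t)) t := by
  have hnhds : Ioo 0 T ∈ 𝓝 t := Ioo_mem_nhds ht.1 ht.2
  have h1 := hasDerivAt_perInt_der_mul_der (hw.hasDerivAt t ht)
    (by filter_upwards [hnhds] with s hs using hw.isDer s hs)
    (by filter_upwards [hnhds] with s hs using hw.isDer_der s hs)
    (hw.continuousOn_der_der.continuousAt hnhds)
  have h2 := perInt.hasFDerivAt.comp_hasDerivAt t
    (hasDerivAt_potential_comp hp (hw.hasDerivAt t ht))
  refine ((h1.const_mul (1 / 2)).sub h2).congr_deriv ?_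
  rw [dissipation, velocity, mul_add (der (der (w t)) + (sourceMap hp).comp (w t)), map_add,
    mul_comm ((sourceMap hp).comp (w t)) (der (der (w t)) + (sourceMap hp).comp (w t))]
  ring

lemma hasDerivAt_sq {p : ℝ} {hp : 1 < p} {T : ℝ} {w : ℝ → Per}
    (hw : IsRegular (sourceMap hp) T w) {t : ℝ} (ht : t ∈ Ioo 0 T) :
    HasDerivAt (fun s => perInt (w s * w s)) (2 * perInt (w t * velocity hp (w t))) t := by
  have h1 := hw.hasDerivAt t ht
  refine (perInt.hasFDerivAt.comp_hasDerivAt t (h1.mul h1)).congr_deriv ?_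
  change perInt (velocity hp (w t) * w t + w t * velocity hp (w t)) = _
  rw [mul_comm (velocity hp (w t)) (w t), map_add]
  ring

/-- Testing the equation with `w` gives `-2 ∫ w_x² + 2 (p + 1) ∫ potential`, and the energy
eliminates `∫ w_x²`. By `hasDerivAt_sq` this is the growth rate of `∫ w²`; both the `L²`-based
bounds and the blow-up argument rest on it. -/
lemma two_mul_perInt_mul_velocity {p : ℝ} {hp : 1 < p} {T : ℝ} {w : ℝ → Per}
    (hw : IsRegular (sourceMap hp) T w) {t : ℝ} (ht : t ∈ Ioo 0 T) :
    2 * perInt (w t * velocity hp (w t)) = -4 * energy hp (w t) +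
      2 * (p - 1) * perInt ((potentialMap hp).comp (w t)) := by
  have h1 := (hw.isDer t ht).perInt_mul (hw.isDer_der t ht)
  have h2 : w t * (sourceMap hp).comp (w t) = (p + 1) • (potentialMap hp).comp (w t) := by
    ext x
    exact mul_source_eq hp (w t x)
  rw [velocity, mul_add, map_add, h2, map_smul, smul_eq_mul, energy, h1]
  ring

lemma continuousOn_dissipation {p : ℝ} {hp : 1 < p} {T : ℝ} {w : ℝ → Per}
    (hw : IsRegular (sourceMap hp) T w) :
    ContinuousOn (fun t => dissipation hp (w t)) (Ioo 0 T) := by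
  have h1 : ContinuousOn (fun t => velocity hp (w t)) (Ioo 0 T) :=
    hw.continuousOn_der_der.add ((ContinuousMap.continuous_postcomp (sourceMap hp)).comp_continuousOn
      (hw.continuousOn.mono Ioo_subset_Ico_self))
  exact perInt.continuous.comp_continuousOn (h1.mul h1)

end IsRegular

/-! ### The energy is unbounded at explosion -/

/-- Gronwall's inequality in integral form, with an explicit primitive `A` of the coefficient. -/
lemma le_mul_exp_of_le_add_integral {m a A : ℝ → ℝ} {c t₀ T : ℝ}
    (hm : ContinuousOn m (Ico t₀ T)) (ha : ContinuousOn a (Ico t₀ T))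
    (hA : ∀ t ∈ Ico t₀ T, HasDerivAt A (a t) t) (ha0 : ∀ t ∈ Ico t₀ T, 0 ≤ a t)
    (h : ∀ t ∈ Ico t₀ T, m t ≤ c + ∫ s in t₀..t, a s * m s) {t : ℝ} (ht : t ∈ Ico t₀ T) :
    m t ≤ c * Real.exp (A t - A t₀) := by
  have hsub : Icc t₀ t ⊆ Ico t₀ T := fun s hs => ⟨hs.1, hs.2.trans_lt ht.2⟩
  have hc : ContinuousOn (fun s => a s * m s) (Icc t₀ t) := (ha.mul hm).mono hsub
  set Z : ℝ → ℝ := fun t => c + ∫ s in t₀..t, a s * m s with hZ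
  have hZd : ∀ s ∈ Ioo t₀ t, HasDerivAt Z (a s * m s) s := fun s hs => by
    refine (intervalIntegral.integral_hasDerivAt_right ?_ ?_ ?_).const_add c
    · exact (hc.mono (Icc_subset_Icc_right hs.2.le)).intervalIntegrable_of_Icc hs.1.le
    · exact (hc.mono Ioo_subset_Icc_self).stronglyMeasurableAtFilter isOpen_Ioo s hs
    · exact hc.continuousAt (Icc_mem_nhds hs.1 hs.2)
  have hZc : ContinuousOn Z (Icc t₀ t) := by
    refine continuousOn_const.add ?_
    have := intervalIntegral.continuousOn_primitive_interval
      (μ := volume) (f := fun s => a s * m s) (a := t₀) (b := t) (by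
        rw [uIcc_of_le ht.1]; exact hc.integrableOn_Icc)
    rwa [uIcc_of_le ht.1] at this
  have hAc : ContinuousOn A (Icc t₀ t) := fun s hs =>
    (hA s (hsub hs)).continuousAt.continuousWithinAt
  -- As `m ≤ Z` and `a ≥ 0`, one has `Z' = a m ≤ a Z`.
  have hanti : AntitoneOn (fun s => Z s * Real.exp (-A s)) (Icc t₀ t) := by
    refine antitoneOn_of_hasDerivWithinAt_nonpos (convex_Icc _ _)
      (f' := fun s => a s * m s * Real.exp (-A s) + Z s * (Real.exp (-A s) * -a s)) ?_ ?_ ?_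
    · exact hZc.mul (hAc.neg.rexp)
    · intro s hs
      rw [interior_Icc] at hs
      exact ((hZd s hs).mul (hA s (hsub ⟨hs.1.le, hs.2.le⟩)).neg.exp).hasDerivWithinAt
    · intro s hs
      rw [interior_Icc] at hs
      have hs' := hsub ⟨hs.1.le, hs.2.le⟩
      have h1 : a s * m s ≤ a s * Z s := mul_le_mul_of_nonneg_left (h s hs') (ha0 s hs')
      have h2 := mul_nonneg (Real.exp_pos (-A s)).le (sub_nonneg.2 h1)
      linarith
  have h1 := hanti (left_mem_Icc.2 ht.1) (right_mem_Icc.2 ht.1) ht.1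
  have h2 : Z t₀ = c := by simp [hZ]
  simp only [h2] at h1
  have h3 : Z t ≤ c * Real.exp (A t - A t₀) := by
    have := mul_le_mul_of_nonneg_right h1 (Real.exp_pos (A t)).le
    rw [mul_assoc, ← Real.exp_add, mul_assoc, ← Real.exp_add] at this
    rw [neg_add_cancel, Real.exp_zero, mul_one] at this
    rwa [show -A t₀ + A t = A t - A t₀ by ring] at this
  exact (h t ht).trans h3

/-- The potential of a solution at one time is controlled by integrals over one period. -/
lemma potential_le {p : ℝ} (hp : 1 < p) {φ : Per} (h1 : IsDer φ (der φ))
    (h2 : IsDer (der φ) (der (der φ))) (x : AddCircle (2 : ℝ)) :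
    2 * potential p (φ x) ≤ 3 / 2 * perInt (der φ * der φ) + perInt ((potentialMap hp).comp φ) +
      dissipation hp φ := by
  -- The first integral of the stationary equation `φ'' + g(φ) = 0`: its derivative is `φ'` times
  -- the velocity, so its oscillation is controlled by the dissipation and `∫ φ'²`.
  set H : Per := (1 / 2 : ℝ) • (der φ * der φ) + (potentialMap hp).comp φ with hH
  have hHd : IsDer H (der φ * velocity hp φ) := fun y => by
    have e1 := ((h2 y).mul (h2 y)).const_mul (1 / 2)
    have e2 := (hasDerivAt_potential hp (φ y)).comp y (h1 y)
    refine (e1.add e2).congr_deriv ?_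
    simp only [velocity, ContinuousMap.mul_apply, ContinuousMap.add_apply,
      ContinuousMap.comp_apply, sourceMap_apply]
    ring
  set D := 1 / 2 * (perInt (der φ * der φ) + dissipation hp φ) with hD
  have habs : ∀ y ∈ Icc (0 : ℝ) 2, ∀ z ∈ Icc (0 : ℝ) 2,
      H (y : AddCircle (2 : ℝ)) - H (z : AddCircle (2 : ℝ)) ≤ D := by
    intro y hy z hz
    set q : Per := (1 / 2 : ℝ) • (der φ * der φ + velocity hp φ * velocity hp φ) with hq
    have hqle : ∀ r, |(der φ * velocity hp φ) r| ≤ q r := fun r => by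
      simp only [hq, ContinuousMap.smul_apply, ContinuousMap.mul_apply, ContinuousMap.add_apply,
        smul_eq_mul]
      rw [abs_le]
      constructor <;> nlinarith [sq_nonneg (der φ r - velocity hp φ r),
        sq_nonneg (der φ r + velocity hp φ r)]
    have hq0 : ∀ r, 0 ≤ q r := fun r => (abs_nonneg _).trans (hqle r)
    have hqD : perInt q = D := by
      rw [hq, map_smul, map_add, hD, dissipation, smul_eq_mul]
    have hqi := fun a b => (continuous_coe_apply q).intervalIntegrable (μ := volume) a b
    rw [hHd.sub_eq z y, ← hqD, perInt_apply]
    calc (∫ r in z..y, (der φ * velocity hp φ) (r : AddCircle (2 : ℝ)))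
        ≤ |∫ r in z..y, (der φ * velocity hp φ) (r : AddCircle (2 : ℝ))| := le_abs_self _
      _ ≤ |∫ r in z..y, (|(der φ * velocity hp φ) (r : AddCircle (2 : ℝ))|)| :=
          by simpa only [Real.norm_eq_abs] using
            intervalIntegral.norm_integral_le_abs_integral_norm (μ := volume) (a := z) (b := y)
              (f := fun r : ℝ => (der φ * velocity hp φ) (r : AddCircle (2 : ℝ)))
      _ ≤ ∫ r in (0 : ℝ)..2, q (r : AddCircle (2 : ℝ)) := by
        have hci : ∀ a b, IntervalIntegrable
            (fun r : ℝ => |(der φ * velocity hp φ) (r : AddCircle (2 : ℝ))|) volume a b :=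
          fun a b => ((continuous_coe_apply _).abs).intervalIntegrable _ _
        rcases le_total z y with hzy | hzy
        · rw [abs_of_nonneg (intervalIntegral.integral_nonneg hzy fun r _ => abs_nonneg _)]
          refine (intervalIntegral.integral_mono hzy (hci _ _) (hqi _ _)
            fun r => hqle r).trans ?_
          exact intervalIntegral.integral_mono_interval hz.1 hzy hy.2
            (Eventually.of_forall fun r => hq0 r) (hqi _ _)
        · rw [intervalIntegral.integral_symm, abs_neg,
            abs_of_nonneg (intervalIntegral.integral_nonneg hzy fun r _ => abs_nonneg _)]
          refine (intervalIntegral.integral_mono hzy (hci _ _) (hqi _ _)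
            fun r => hqle r).trans ?_
          exact intervalIntegral.integral_mono_interval hy.1 hzy hz.2
            (Eventually.of_forall fun r => hq0 r) (hqi _ _)
  obtain ⟨y, hy, rfl⟩ := (AddCircle.coe_image_Icc_eq 2 (0 : ℝ)).symm ▸ mem_univ x
  rw [zero_add] at hy
  -- Comparison of the value at `y` with the average over a period of length `2`.
  have h3 : ∫ _ in (0 : ℝ)..2, (H (y : AddCircle (2 : ℝ)) - D) ≤ perInt H := by
    rw [perInt_apply]
    refine intervalIntegral.integral_mono_on zero_le_two (by simp)
      ((continuous_coe_apply H).intervalIntegrable _ _) fun z hz => ?_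
    linarith [habs y hy z hz]
  rw [intervalIntegral.integral_const, smul_eq_mul, sub_zero] at h3
  have h4 : potential p (φ y) ≤ H y := by
    simp only [hH, ContinuousMap.add_apply, ContinuousMap.smul_apply, ContinuousMap.mul_apply,
      ContinuousMap.comp_apply, potentialMap_apply, smul_eq_mul]
    nlinarith [mul_self_nonneg (der φ y)]
  have h5 : perInt H = 1 / 2 * perInt (der φ * der φ) + perInt ((potentialMap hp).comp φ) := by
    rw [hH, map_add, map_smul, smul_eq_mul]
  rw [h5] at h3
  linarith

/-- It makes the source linear in `|r|`, with a coefficient controlled by the potential, as Gronwall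
requires. -/
lemma rpow_sub_one_le_one_add {p r : ℝ} (hp : 1 < p) :
    |r| ^ (p - 1) ≤ 1 + (p + 1) * potential p r := by
  rw [potential, mul_div_cancel₀ _ (by linarith : p + 1 ≠ 0)]
  rcases le_total |r| 1 with h | h
  · have h1 : |r| ^ (p - 1) ≤ 1 := Real.rpow_le_one (abs_nonneg r) h (by linarith)
    have h2 : 0 ≤ |r| ^ (p + 1) := Real.rpow_nonneg (abs_nonneg r) _
    linarith
  · have h1 : |r| ^ (p - 1) ≤ |r| ^ (p + 1) := Real.rpow_le_rpow_of_exponent_le h (by linarith)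
    linarith

namespace IsRegular

lemma antitoneOn_energy {p : ℝ} {hp : 1 < p} {T : ℝ} {w : ℝ → Per}
    (hw : IsRegular (sourceMap hp) T w) : AntitoneOn (fun t => energy hp (w t)) (Ioo 0 T) := by
  refine antitoneOn_of_hasDerivWithinAt_nonpos (convex_Ioo _ _)
    (f' := fun t => -dissipation hp (w t))
    (fun t ht => (hw.hasDerivAt_energy ht).continuousAt.continuousWithinAt) ?_ ?_
  · intro t ht
    rw [interior_Ioo] at ht
    exact (hw.hasDerivAt_energy ht).hasDerivWithinAt
  · intro t _
    have := perInt_mul_self_nonneg (velocity hp (w t))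
    rw [dissipation]
    linarith

/-- If the energy is bounded below, the solution is bounded in `L²`. -/
lemma exists_perInt_mul_self_le {p : ℝ} {hp : 1 < p} {T K : ℝ} {w : ℝ → Per}
    (hw : IsRegular (sourceMap hp) T w) (hK : ∀ t ∈ Ioo 0 T, -K ≤ energy hp (w t)) {t₀ : ℝ}
    (ht₀ : t₀ ∈ Ioo 0 T) : ∃ Y, ∀ t ∈ Ico t₀ T, perInt (w t * w t) ≤ Y := by
  -- The derivative of `∫ w² + E` is `2 ∫ w v - ∫ v² ≤ ∫ w²`, with `v` the velocity, and `E + K ≥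
  -- 0`. So `∫ w² + E + K` grows at most like `exp t`.
  set G : ℝ → ℝ := fun t => (perInt (w t * w t) + energy hp (w t) + K) * Real.exp (-t) with hG
  have hsub : Ico t₀ T ⊆ Ioo 0 T := fun t ht => ⟨ht₀.1.trans_le ht.1, ht.2⟩
  have hGd : ∀ t ∈ Ioo 0 T, HasDerivAt G ((2 * perInt (w t * velocity hp (w t)) +
      -dissipation hp (w t)) * Real.exp (-t) +
      (perInt (w t * w t) + energy hp (w t) + K) * (Real.exp (-t) * -1)) t := fun t ht =>
    (((hw.hasDerivAt_sq ht).add (hw.hasDerivAt_energy ht)).add_const K).mul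
      (hasDerivAt_neg t).exp
  have hanti : AntitoneOn G (Ico t₀ T) := by
    refine antitoneOn_of_hasDerivWithinAt_nonpos (convex_Ico _ _)
      (fun t ht => (hGd t (hsub ht)).continuousAt.continuousWithinAt)
      (fun t ht => (hGd t (hsub (interior_subset ht))).hasDerivWithinAt) fun t ht => ?_
    have ht' := hsub (interior_subset ht)
    have h1 := perInt_two_mul_le (w t) (velocity hp (w t))
    have h2 := hK t ht'
    have h3 := mul_nonneg (Real.exp_pos (-t)).le (sub_nonneg.2 h1)
    have h4 := mul_nonneg (Real.exp_pos (-t)).le (neg_le_iff_add_nonneg.1 h2)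
    rw [dissipation]
    linarith
  refine ⟨G t₀ * Real.exp T, fun t ht => ?_⟩
  have h1 : G t ≤ G t₀ := hanti ⟨le_rfl, ht₀.2⟩ ht ht.1
  have h2 : perInt (w t * w t) + energy hp (w t) + K = G t * Real.exp t := by
    rw [hG, mul_assoc, ← Real.exp_add, neg_add_cancel, Real.exp_zero, mul_one]
  have h3 : 0 ≤ G t₀ := mul_nonneg (by
    have := hK t₀ ht₀
    have := perInt_mul_self_nonneg (w t₀)
    linarith) (Real.exp_pos _).le
  have h4 : G t * Real.exp t ≤ G t₀ * Real.exp T := by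
    have := ht.2.le
    gcongr
  have h5 := hK t (hsub ht)
  linarith

/-- A solution whose energy is bounded below on a finite time interval is bounded. -/
lemma exists_norm_le_of_energy {p : ℝ} {hp : 1 < p} {T K : ℝ} {w : ℝ → Per} (hT : 0 < T)
    (hw : IsRegular (sourceMap hp) T w) (hK : ∀ t ∈ Ioo 0 T, -K ≤ energy hp (w t)) :
    ∃ B, ∀ t ∈ Ico 0 T, ‖w t‖ ≤ B := by
  -- The energy is used from a positive time on, since the datum need not be differentiable.
  obtain ⟨t₀, ht₀⟩ : ∃ t₀, t₀ ∈ Ioo 0 T := exists_between hT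
  have hsub : Ico t₀ T ⊆ Ioo 0 T := fun t ht => ⟨ht₀.1.trans_le ht.1, ht.2⟩
  obtain ⟨Y, hY⟩ := hw.exists_perInt_mul_self_le hK ht₀
  set E₀ := energy hp (w t₀) with hE₀
  have hE : ∀ t ∈ Ico t₀ T, energy hp (w t) ≤ E₀ := fun t ht =>
    hw.antitoneOn_energy ht₀ (hsub ht) ht.1
  have hp1 : 0 < p - 1 := by linarith
  -- The `L²` bound and the growth rate of `∫ w²` control `∫ potential` by the dissipation. The
  -- energy upper bound then controls `∫ w_x²`, and `potential_le` makes the estimate pointwise.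
  obtain ⟨C, hC⟩ : ∃ C, ∀ t ∈ Ico t₀ T, ∀ x,
      2 * potential p (w t x) ≤ C + (2 / (p - 1) + 1) * dissipation hp (w t) := by
    refine ⟨2 / (p - 1) * (Y + 4 * |E₀|) + 3 * |E₀|, fun t ht x => ?_⟩
    have h1 := potential_le hp (hw.isDer t (hsub ht)) (hw.isDer_der t (hsub ht)) x
    have h2 := hw.two_mul_perInt_mul_velocity (hsub ht)
    have h3 := perInt_two_mul_le (w t) (velocity hp (w t))
    have h4 := hY t ht
    have h5 : energy hp (w t) ≤ |E₀| := (hE t ht).trans (le_abs_self _)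
    set P := perInt ((potentialMap hp).comp (w t)) with hP
    set n := dissipation hp (w t) with hn
    have h6 : 2 * (p - 1) * P ≤ Y + 4 * |E₀| + n := by
      have : perInt (velocity hp (w t) * velocity hp (w t)) = n := rfl
      linarith
    have h7 : P ≤ (Y + 4 * |E₀| + n) / (2 * (p - 1)) := by
      rw [le_div_iff₀ (by positivity)]; linarith
    have h8 : 1 / 2 * perInt (der (w t) * der (w t)) ≤ |E₀| + P := by
      have : energy hp (w t) = 1 / 2 * perInt (der (w t) * der (w t)) - P := rfl
      linarith
    have h9 : 2 / (p - 1) * (Y + 4 * |E₀|) + 3 * |E₀| + (2 / (p - 1) + 1) * n =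
        4 * ((Y + 4 * |E₀| + n) / (2 * (p - 1))) + 3 * |E₀| + n := by
      field_simp
      ring
    rw [h9]
    linarith
  set β := (p + 1) / 2 * (2 / (p - 1) + 1) with hβ
  have hβ0 : 0 ≤ β := by positivity
  set α := 1 + (p + 1) / 2 * |C| with hα
  have hα0 : 0 ≤ α := by positivity
  have hdiss0 : ∀ t, 0 ≤ dissipation hp (w t) := fun t => perInt_mul_self_nonneg _
  have hsource : ∀ t ∈ Ico t₀ T,
      ‖(sourceMap hp).comp (w t)‖ ≤ (α + β * dissipation hp (w t)) * ‖w t‖ := by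
    intro t ht
    have h0 : 0 ≤ α + β * dissipation hp (w t) :=
      add_nonneg hα0 (mul_nonneg hβ0 (hdiss0 t))
    refine (ContinuousMap.norm_le _ (mul_nonneg h0 (norm_nonneg _))).2 fun x => ?_
    rw [ContinuousMap.comp_apply, sourceMap_apply, Real.norm_eq_abs, abs_source]
    refine mul_le_mul ?_ ((w t).norm_coe_le_norm x) (abs_nonneg _) h0
    refine (rpow_sub_one_le_one_add hp).trans ?_
    have h1 := mul_le_mul_of_nonneg_left (hC t ht x) (by positivity : 0 ≤ (p + 1) / 2)
    have h2 := mul_le_mul_of_nonneg_left (le_abs_self C) (by positivity : 0 ≤ (p + 1) / 2)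
    rw [hα, hβ]
    linarith
  have hwc : ContinuousOn w (Ico t₀ T) := hw.continuousOn.mono fun t ht => ⟨(hsub ht).1.le, ht.2⟩
  have hac : ContinuousOn (fun t => α + β * dissipation hp (w t)) (Ico t₀ T) :=
    continuousOn_const.add (continuousOn_const.mul (hw.continuousOn_dissipation.mono hsub))
  -- The coefficient `α + β · dissipation` has the explicit primitive `α t - β E`, bounded above
  -- because `E ≥ -K` and `t < T`.
  have hgron : ∀ t ∈ Ico t₀ T,
      ‖w t‖ ≤ ‖w t₀‖ * Real.exp ((α * t - β * energy hp (w t)) - (α * t₀ - β * E₀)) := by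
    intro t ht
    refine le_mul_exp_of_le_add_integral (m := fun t => ‖w t‖)
      (a := fun t => α + β * dissipation hp (w t)) (A := fun t => α * t - β * energy hp (w t))
      hwc.norm hac (fun s hs => ?_) (fun s _ => add_nonneg hα0 (mul_nonneg hβ0 (hdiss0 s)))
      (fun s hs => ?_) ht
    · refine (((hasDerivAt_id s).const_mul α).sub
        ((hw.hasDerivAt_energy (hsub hs)).const_mul β)).congr_deriv ?_
      ring
    · refine (hw.norm_le t₀ s ht₀.1.le hs.1 hs.2).trans ?_
      have hss : Icc t₀ s ⊆ Ico t₀ T := fun r hr => ⟨hr.1, hr.2.trans_lt hs.2⟩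
      gcongr
      refine intervalIntegral.integral_mono_on hs.1 ?_ ?_ fun r hr => hsource r (hss hr)
      · exact (((ContinuousMap.continuous_postcomp (sourceMap hp)).comp_continuousOn
          (hwc.mono hss)).norm).intervalIntegrable_of_Icc hs.1
      · exact ((hac.mul hwc.norm).mono hss).intervalIntegrable_of_Icc hs.1
  obtain ⟨B₀, hB₀⟩ := isCompact_Icc.exists_bound_of_continuousOn
    (hw.continuousOn.mono fun t (ht : t ∈ Icc 0 t₀) => ⟨ht.1, ht.2.trans_lt ht₀.2⟩)
  refine ⟨max B₀ (‖w t₀‖ * Real.exp ((α * T + β * K) - (α * t₀ - β * E₀))), fun t ht => ?_⟩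
  rcases le_total t t₀ with h | h
  · exact (hB₀ t ⟨ht.1, h⟩).trans (le_max_left _ _)
  · refine (hgron t ⟨h, ht.2⟩).trans (le_trans ?_ (le_max_right _ _))
    have h1 := mul_le_mul_of_nonneg_left (hK t (hsub ⟨h, ht.2⟩)) hβ0
    have h2 := mul_le_mul_of_nonneg_left ht.2.le hα0
    have h3 : α * t - β * energy hp (w t) ≤ α * T + β * K := by linarith
    gcongr

end IsRegular

/-! ### Very negative energy forces quick explosion -/

lemma rpow_add_le {q a b : ℝ} (hq : 0 ≤ q) (ha : 0 ≤ a) (hb : 0 ≤ b) :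
    (a + b) ^ q ≤ 2 ^ q * (a ^ q + b ^ q) := by
  have h1 : (a + b) ^ q ≤ (2 * max a b) ^ q :=
    Real.rpow_le_rpow (by positivity) (by linarith [le_max_left a b, le_max_right a b]) hq
  rw [Real.mul_rpow zero_le_two (ha.trans (le_max_left a b))] at h1
  refine h1.trans (mul_le_mul_of_nonneg_left ?_ (by positivity))
  rcases max_choice a b with h | h <;> rw [h]
  · linarith [Real.rpow_nonneg hb q]
  · linarith [Real.rpow_nonneg ha q]

/-- Jensen's inequality over one period. -/
lemma rpow_perInt_le {p : ℝ} (hp : 1 < p) (φ : Per) :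
    2 * (perInt (φ * φ) / 2) ^ ((p + 1) / 2) ≤ (p + 1) * perInt ((potentialMap hp).comp φ) := by
  -- Jensen is applied to `φ²` and the power `(p + 1) / 2`, for Lebesgue measure normalised on a
  -- period.
  set μ : Measure ℝ := (2⁻¹ : ℝ≥0∞) • volume.restrict (Ioc (0 : ℝ) 2) with hμ
  have hprob : IsProbabilityMeasure μ := ⟨by
    simp [hμ, ENNReal.inv_mul_cancel]⟩
  have hint : ∀ f : ℝ → ℝ, ∫ x, f x ∂μ = (∫ x in (0 : ℝ)..2, f x) / 2 := fun f => by
    rw [hμ, integral_smul_measure, intervalIntegral.integral_of_le zero_le_two]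
    simp; ring
  have hintegrable : ∀ f : ℝ → ℝ, Continuous f → Integrable f μ := fun f hf =>
    (((hf.intervalIntegrable 0 2).1).smul_measure (by simp))
  have hq : 1 ≤ (p + 1) / 2 := by linarith
  have hsq : Continuous fun x : ℝ => (φ * φ) (x : AddCircle (2 : ℝ)) := continuous_coe_apply _
  have hpow : ∀ x : ℝ, ((φ * φ) (x : AddCircle (2 : ℝ))) ^ ((p + 1) / 2) =
      (p + 1) * (potentialMap hp).comp φ (x : AddCircle (2 : ℝ)) := fun x => by
    have h1 : p + 1 ≠ 0 := by linarith
    rw [ContinuousMap.mul_apply, ContinuousMap.comp_apply, potentialMap_apply, potential,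
      mul_div_cancel₀ _ h1, ← abs_mul_abs_self, ← sq, ← Real.rpow_natCast,
      ← Real.rpow_mul (abs_nonneg _)]
    congr 1
    push_cast
    ring
  have hj := (convexOn_rpow hq).map_integral_le (μ := μ)
    (f := fun x : ℝ => (φ * φ) (x : AddCircle (2 : ℝ)))
    (Real.continuous_rpow_const (by linarith)).continuousOn isClosed_Ici
    (Eventually.of_forall fun x => mul_self_nonneg (φ (x : AddCircle (2 : ℝ))))
    (hintegrable _ hsq) (hintegrable _ (hsq.rpow_const fun x => Or.inr (by linarith)))
  simp only [hpow] at hj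
  rw [hint, hint, intervalIntegral.integral_const_mul, ← perInt_apply, ← perInt_apply] at hj
  linarith

/-- If the energy is very negative at time `t₁`, the solution explodes shortly after. -/
lemma exists_energy_le_imp_le {p : ℝ} (hp : 1 < p) {ε : ℝ} (hε : 0 < ε) :
    ∃ K, ∀ (T : ℝ) (w : ℝ → Per), IsRegular (sourceMap hp) T w → ∀ t₁ ∈ Ioo 0 T,
      energy hp (w t₁) ≤ -K → T ≤ t₁ + ε := by
  set q := (p + 1) / 2 with hq
  have hq1 : 1 < q := by rw [hq]; linarith
  set c := 2 * (p - 1) / (p + 1) with hc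
  have hc0 : 0 < c := div_pos (by linarith) (by linarith)
  set κ := (q - 1) * (c / 2 ^ q) with hκ
  have hκ0 : 0 < κ := mul_pos (by linarith) (by positivity)
  -- A function with `z' ≥ (c / 2^q) z^q` and initial value at least `a` lasts at most `a^(1 - q) /
  -- κ`, which must be less than `ε`.
  obtain ⟨a, ha0, ha⟩ : ∃ a : ℝ, 0 < a ∧ a ^ (1 - q) < κ * ε := by
    have h1 : Tendsto (fun a : ℝ => a ^ (-(q - 1))) atTop (𝓝 0) :=
      tendsto_rpow_neg_atTop (by linarith)
    obtain ⟨a, h2, h3⟩ := ((h1.eventually_lt_const (mul_pos hκ0 hε)).and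
      (eventually_gt_atTop 0)).exists
    exact ⟨a, h3, by rwa [neg_sub] at h2⟩
  -- With this threshold `-2E` contributes `c a^q` to the growth of `½ ∫ w²`. This pays for the
  -- shift by `a` below, so no lower bound on `∫ w²` at time `t₁` is needed.
  refine ⟨c * a ^ q / 2, fun T w hw t₁ ht₁ hE => ?_⟩
  set z : ℝ → ℝ := fun t => a + perInt (w t * w t) / 2 with hz
  have hzpos : ∀ t, 0 < z t := fun t => by
    have := perInt_mul_self_nonneg (w t)
    positivity
  have hsub : Ico t₁ T ⊆ Ioo 0 T := fun t ht => ⟨ht₁.1.trans_le ht.1, ht.2⟩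
  have hzd : ∀ t ∈ Ioo 0 T, HasDerivAt z (2 * perInt (w t * velocity hp (w t)) / 2) t :=
    fun t ht => ((hw.hasDerivAt_sq ht).div_const 2).const_add a
  have hzd' : ∀ t ∈ Ico t₁ T,
      c / 2 ^ q * z t ^ q ≤ 2 * perInt (w t * velocity hp (w t)) / 2 := fun t ht => by
    rw [hw.two_mul_perInt_mul_velocity (hsub ht)]
    have h1 : energy hp (w t) ≤ -(c * a ^ q / 2) :=
      (hw.antitoneOn_energy ht₁ (hsub ht) ht.1).trans hE
    have h2 := rpow_perInt_le hp (w t)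
    rw [← hq] at h2
    have h3 := rpow_add_le (q := q) (by linarith) ha0.le
      (div_nonneg (perInt_mul_self_nonneg (w t)) zero_le_two)
    have h4 : c / 2 ^ q * z t ^ q ≤ c * (a ^ q + (perInt (w t * w t) / 2) ^ q) := by
      rw [div_mul_eq_mul_div, div_le_iff₀ (by positivity), mul_assoc]
      refine mul_le_mul_of_nonneg_left ?_ hc0.le
      rw [mul_comm _ ((2 : ℝ) ^ q)]
      exact h3
    have h5 : c * (perInt (w t * w t) / 2) ^ q ≤
        (p - 1) * perInt ((potentialMap hp).comp (w t)) := by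
      have h6 := mul_le_mul_of_nonneg_left h2
        (div_nonneg (by linarith : 0 ≤ p - 1) (by linarith : 0 ≤ p + 1))
      have h7 : p + 1 ≠ 0 := by linarith
      rw [← mul_assoc (_ / _) (p + 1), div_mul_cancel₀ _ h7] at h6
      refine le_trans (le_of_eq ?_) h6
      rw [hc]; ring
    linarith
  -- The differential inequality integrated: `z^(1 - q)` decreases at least at the rate `κ` while
  -- remaining positive.
  have hanti : AntitoneOn (fun t => z t ^ (1 - q) + κ * t) (Ico t₁ T) := by
    have hd : ∀ t ∈ Ioo 0 T, HasDerivAt (fun t => z t ^ (1 - q) + κ * t)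
        (2 * perInt (w t * velocity hp (w t)) / 2 * (1 - q) * z t ^ (1 - q - 1) + κ * 1) t :=
      fun t ht => ((hzd t ht).rpow_const (Or.inl (hzpos t).ne')).add
        ((hasDerivAt_id t).const_mul κ)
    refine antitoneOn_of_hasDerivWithinAt_nonpos (convex_Ico _ _)
      (fun t ht => (hd t (hsub ht)).continuousAt.continuousWithinAt)
      (fun t ht => (hd t (hsub (interior_subset ht))).hasDerivWithinAt) fun t ht => ?_
    have h1 := hzd' t (interior_subset ht)
    have h2 : z t ^ (1 - q - 1) * z t ^ q = 1 := by
      rw [← Real.rpow_add (hzpos t)]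
      norm_num
    have h3 : 0 ≤ (q - 1) * z t ^ (1 - q - 1) :=
      mul_nonneg (by linarith) (Real.rpow_nonneg (hzpos t).le _)
    have h4 := mul_le_mul_of_nonneg_left h1 h3
    have h5 : (q - 1) * z t ^ (1 - q - 1) * (c / 2 ^ q * z t ^ q) = κ := by
      rw [hκ]
      linear_combination (q - 1) * (c / 2 ^ q) * h2
    linarith
  by_contra! hlt
  have ht : t₁ + ε ∈ Ico t₁ T := ⟨by linarith, hlt⟩
  have h1 := hanti ⟨le_rfl, ht₁.2⟩ ht ht.1
  have h2 : z t₁ ^ (1 - q) ≤ a ^ (1 - q) := by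
    refine Real.rpow_le_rpow_of_nonpos ha0 ?_ (by linarith)
    have := perInt_mul_self_nonneg (w t₁)
    rw [hz]
    linarith
  have h3 : 0 ≤ z (t₁ + ε) ^ (1 - q) := Real.rpow_nonneg (hzpos _).le _
  simp only at h1
  linarith

/-! ### Continuity of the explosion time -/

lemma explosionTime_pos {p : ℝ} (hp : 1 < p) (u : DirichletData) : 0 < explosionTime p u := by
  have hM : 0 < ‖oddExt u‖ + 1 := by positivity
  have h : IsGood hp (‖oddExt u‖ + 1) u 0 := ⟨hM, fun t ht => by
    rw [le_antisymm ht.2 ht.1, (isMild_truncSol hp hM u).apply_zero]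
    exact lt_add_one _⟩
  simpa using h.lt_explosionTime le_rfl

/-- Positivity of `t` is essential: the energy is not continuous in the supremum norm, and smoothing
supplies the control of the space derivative. -/
lemma continuousAt_energy_truncSol {p : ℝ} (hp : 1 < p) {M t : ℝ} (hM : 0 < M) (ht : 0 < t)
    (u : DirichletData) : ContinuousAt (fun v => energy hp (truncSol hp M v t)) u := by
  have htame := isTame_trunc hp hM
  obtain ⟨C, hC⟩ := htame.exists_norm_der_sub_le ht
  have hlip : ∀ (f : DirichletData → Per) (C : ℝ),
      (∀ v, ‖f v - f u‖ ≤ C * ‖oddExt v - oddExt u‖) → ContinuousAt f u := by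
    intro f C hf
    rw [ContinuousAt, tendsto_iff_norm_sub_tendsto_zero]
    refine squeeze_zero (fun v => norm_nonneg _) (g := fun v => |C| * dist v u) (fun v => ?_) ?_
    · refine (hf v).trans ?_
      have := norm_oddExt_sub_le v u
      have := le_abs_self C
      gcongr
    · have hc : Continuous fun v : DirichletData => |C| * dist v u := by fun_prop
      simpa using hc.tendsto u
  have h1 : ContinuousAt (fun v => der (truncSol hp M v t)) u :=
    hlip _ C fun v => hC _ _ _ _ (isMild_truncSol hp hM v) (isMild_truncSol hp hM u)
  have h2 : ContinuousAt (fun v => truncSol hp M v t) u :=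
    hlip _ (2 * Real.exp (2 * (p * M ^ (p - 1)) * t)) fun v => by
      refine (htame.norm_sub_le_of_isMild (isMild_truncSol hp hM v) (isMild_truncSol hp hM u)
        ht.le).trans (le_of_eq (by ring))
  exact (continuousAt_const.mul (perInt.continuous.continuousAt.comp (h1.mul h1))).sub
    (perInt.continuous.continuousAt.comp
      ((ContinuousMap.continuous_postcomp (potentialMap hp)).continuousAt.comp h2))

lemma eventually_lt_explosionTime {p : ℝ} (hp : 1 < p) {u : DirichletData} {a : ℝ≥0∞}
    (ha : a < explosionTime p u) : ∀ᶠ v in 𝓝 u, a < explosionTime p v := by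
  obtain ⟨s, hs0, has, hsu⟩ := ENNReal.lt_iff_exists_real_btwn.1 ha
  obtain ⟨M, hM⟩ := exists_isGood hp hsu
  filter_upwards [hM.eventually] with v hv
  exact has.trans (hv.lt_explosionTime hs0)

/-- At a finite explosion time the energy is unbounded below. -/
lemma exists_energy_lt {p : ℝ} {hp : 1 < p} {u : DirichletData} {T : ℝ} (hT : 0 < T)
    (hu : explosionTime p u = ENNReal.ofReal T) {w : ℝ → Per}
    (hw : IsRegular (sourceMap hp) T w) (h0 : w 0 = oddExt u) (K : ℝ) :
    ∃ t ∈ Ioo 0 T, energy hp (w t) < -K := by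
  by_contra! h
  obtain ⟨B, hB⟩ := hw.exists_norm_le_of_energy hT h
  exact absurd (hw.lt_explosionTime hp hT h0 hB) (by rw [hu]; exact lt_irrefl _)

lemma eventually_explosionTime_lt {p : ℝ} (hp : 1 < p) {u : DirichletData}
    (hu : u ∈ explosionDomain p) {a : ℝ≥0∞} (ha : explosionTime p u < a) :
    ∀ᶠ v in 𝓝 u, explosionTime p v < a := by
  have hutop : explosionTime p u ≠ ∞ := ne_of_lt hu
  set T := (explosionTime p u).toReal with hTdef
  have hTeq : explosionTime p u = ENNReal.ofReal T := (ENNReal.ofReal_toReal hutop).symm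
  have hT : 0 < T := ENNReal.toReal_pos (explosionTime_pos hp u).ne' hutop
  obtain ⟨r, hr0, hur, hra⟩ := ENNReal.lt_iff_exists_real_btwn.1 ha
  have hTr : T < r := by
    rw [hTeq] at hur
    exact (ENNReal.ofReal_lt_ofReal_iff_of_nonneg hT.le).1 hur
  -- The delay allowed is `r - T`. As `t₁ < T`, an explosion by `t₁ + (r - T)` occurs before `r`.
  obtain ⟨K, hK⟩ := exists_energy_le_imp_le hp (sub_pos.2 hTr)
  obtain ⟨w, hw, h0, hwM⟩ := exists_isRegular hp hT hTeq.ge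
  obtain ⟨t₁, ht₁, hE⟩ := exists_energy_lt hT hTeq hw h0 K
  obtain ⟨M, hM⟩ := exists_isGood hp (u := u) (s := t₁) (by
    rw [hTeq]; exact (ENNReal.ofReal_lt_ofReal_iff hT).2 ht₁.2)
  -- At time `t₁` the solution is written at one level `M` that also serves nearby data, so the
  -- energies compared are values of one continuous function of the datum.
  rw [hwM M t₁ ht₁.2 hM t₁ ⟨ht₁.1.le, le_rfl⟩] at hE
  filter_upwards [hM.eventually,
    (continuousAt_energy_truncSol hp hM.1 ht₁.1 u).eventually_lt_const hE] with v hvM hvE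
  refine lt_of_le_of_lt ?_ hra
  by_contra! hlt
  obtain ⟨T', hT'0, hrT', hT'v⟩ := ENNReal.lt_iff_exists_real_btwn.1 hlt
  have hrT : r < T' := (ENNReal.ofReal_lt_ofReal_iff_of_nonneg hr0).1 hrT'
  obtain ⟨w', hw', -, hwM'⟩ := exists_isRegular hp (hr0.trans_lt hrT) hT'v.le
  have ht₁' : t₁ < T' := ht₁.2.trans (hTr.trans hrT)
  have h1 := hK T' w' hw' t₁ ⟨ht₁.1, ht₁'⟩ (by
    rw [hwM' M t₁ ht₁' hvM t₁ ⟨ht₁.1.le, le_rfl⟩]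
    exact hvE.le)
  linarith [ht₁.2]

end ReactionDiffusion

end

theorem corollary4p4 (p : ℝ) (hp : 1 < p) :
    ContinuousOn (fun u : ReactionDiffusion.DirichletData => ReactionDiffusion.explosionTime p u)
      (ReactionDiffusion.explosionDomain p) := by
  intro u hu
  refine ContinuousAt.continuousWithinAt (tendsto_order.2 ⟨fun a ha => ?_, fun a ha => ?_⟩)
  · exact ReactionDiffusion.eventually_lt_explosionTime hp ha
  · exact ReactionDiffusion.eventually_explosionTime_lt hp hu ha
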